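/- Let $0<\lambda\le L<\infty$, and let $M(\lambda,L)$ be the collection of symmetric $2\times 2$ matrix fields $A$ on $\mathbb{R}^2$ with bounded measurable coefficients such that $\lambda|\xi|^2\le A(x)\xi\cdot\xi\le L|\xi|^2$ for all $x,\xi\in\mathbb{R}^2$. A function $u\in H^1_{\mathrm{loc}}(\mathbb{R}^2)$ is a weak solution of $\operatorname{div}(A\nabla u)=0$ in $\mathbb{R}^2$ if $\int_{\mathbb{R}^2}A\nabla u\cdot\nabla\varphi\,dx=0$ for every $\varphi\in C_c^\infty(\mathbb{R}^2)$. Pointwise statements about $u$ are understood almost everywhere. (i) Let $A\in M(\lambda,L)$ and let $u\in H^1_{\mathrm{loc}}(\mathbb{R}^2)$ be a weak solution of $\operatorname{div}(A\nabla u)=0$ in $\mathbb{R}^2$. If for some $\gamma\in\bigl(0,\sqrt{\lambda/L}\bigr)$ there is $C>0$ with $|u(x)|\le C(1+|x|^\gamma)$ in $\mathbb{R}^2$, then $u$ is constant. (ii) The optimal Liouville exponent $k^*(2,\lambda,L)$ of the class $M(\lambda,L)$ equals $\sqrt{\lambda/L}$. Here $k^*(2,\lambda,L)$ is the supremum of all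 $\gamma>0$ with the following property: whenever $A\in M(\lambda,L)$ and $u\in H^1_{\mathrm{loc}}(\mathbb{R}^2)$ is a weak solution of $\operatorname{div}(A\nabla u)=0$ in $\mathbb{R}^2$ with $|u(x)|\le C(1+|x|^\gamma)$ in $\mathbb{R}^2$ for some $C>0$, then $u$ is constant. -/

import Mathlib

open MeasureTheory
open scoped Matrix ContDiff

namespace Liouville

/-- The class `M(lam, L)`: symmetric matrix fields on `ℝⁿ` with (Lebesgue) measurable coefficients
satisfying `lam |ξ|² ≤ A(x)ξ · ξ ≤ L |ξ|²`. The coefficients are then automatically bounded, since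
a symmetric matrix satisfying the two inequalities with `0 ≤ lam` has entries at most `L` in
absolute value. -/
def EllipticClass (n : ℕ) (lam L : ℝ) :
    Set (EuclideanSpace ℝ (Fin n) → Matrix (Fin n) (Fin n) ℝ) :=
  {A | (∀ i j, AEMeasurable (fun x => A x i j) volume) ∧
    (∀ x, (A x).IsSymm) ∧
    ∀ x ξ : EuclideanSpace ℝ (Fin n),
      lam * ‖ξ‖ ^ 2 ≤ (A x *ᵥ ξ.ofLp) ⬝ᵥ ξ.ofLp ∧
      (A x *ᵥ ξ.ofLp) ⬝ᵥ ξ.ofLp ≤ L * ‖ξ‖ ^ 2}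

/-- Test functions: `C_c^∞(ℝⁿ)`. -/
def IsTestFunction {n : ℕ} (φ : EuclideanSpace ℝ (Fin n) → ℝ) : Prop :=
  ContDiff ℝ ∞ φ ∧ HasCompactSupport φ

/-- `f ∈ L²_loc(ℝⁿ; F)`. -/
def MemL2loc {n : ℕ} {F : Type*} [NormedAddCommGroup F]
    (f : EuclideanSpace ℝ (Fin n) → F) : Prop :=
  ∀ K : Set (EuclideanSpace ℝ (Fin n)), IsCompact K → MemLp f 2 (volume.restrict K)

/-- `u ∈ H¹_loc(ℝⁿ)` with weak gradient `V`: both `u` and `V` are in `L²_loc`, and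
`∫ u ∂ᵢφ = - ∫ Vᵢ φ` for every test function `φ` and every index `i`. -/
def IsH1locWithGradient {n : ℕ} (u : EuclideanSpace ℝ (Fin n) → ℝ)
    (V : EuclideanSpace ℝ (Fin n) → EuclideanSpace ℝ (Fin n)) : Prop :=
  MemL2loc u ∧ MemL2loc V ∧
    ∀ φ : EuclideanSpace ℝ (Fin n) → ℝ, IsTestFunction φ → ∀ i : Fin n,
      ∫ x, u x * (gradient φ x) i = - ∫ x, (V x) i * φ x

/-- `u ∈ H¹_loc(ℝⁿ)` is a weak solution of `-div(A ∇u) = 0` in `ℝⁿ`: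
`∫ A ∇u · ∇φ = 0` for every test function `φ`. (The weak gradient `V` is unique up to null sets.) -/
def IsWeakSolution {n : ℕ} (A : EuclideanSpace ℝ (Fin n) → Matrix (Fin n) (Fin n) ℝ)
    (u : EuclideanSpace ℝ (Fin n) → ℝ) : Prop :=
  ∃ V : EuclideanSpace ℝ (Fin n) → EuclideanSpace ℝ (Fin n), IsH1locWithGradient u V ∧
    ∀ φ : EuclideanSpace ℝ (Fin n) → ℝ, IsTestFunction φ →
      ∫ x, (A x *ᵥ (V x).ofLp) ⬝ᵥ (gradient φ x).ofLp = 0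

/-- The growth condition `|u(x)| ≤ C (1 + |x|^γ)` in `ℝⁿ` for some `C > 0`, for the element `u` of
`H¹_loc`, hence almost everywhere. -/
def HasGrowth {n : ℕ} (u : EuclideanSpace ℝ (Fin n) → ℝ) (γ : ℝ) : Prop :=
  ∃ C : ℝ, 0 < C ∧ ∀ᵐ x ∂volume, |u x| ≤ C * (1 + ‖x‖ ^ γ)

/-- `u` is constant as an element of `H¹_loc`. -/
def IsAEConst {n : ℕ} (u : EuclideanSpace ℝ (Fin n) → ℝ) : Prop :=
  ∃ c : ℝ, ∀ᵐ x ∂volume, u x = c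

/-- The exponents `γ > 0` such that every entire weak solution of growth `γ`, for a matrix field in
the family `𝓕`, is constant. -/
def liouvilleExponents {n : ℕ}
    (𝓕 : Set (EuclideanSpace ℝ (Fin n) → Matrix (Fin n) (Fin n) ℝ)) : Set ℝ :=
  {γ | 0 < γ ∧ ∀ A ∈ 𝓕, ∀ u : EuclideanSpace ℝ (Fin n) → ℝ,
    IsWeakSolution A u → HasGrowth u γ → IsAEConst u}

/-- `k` is the optimal Liouville exponent in the family `𝓕`: the supremum (in `ℝ`) of the
exponents for which the Liouville property holds throughout `𝓕`. -/
def IsOptimalLiouvilleExponent {n : ℕ}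
    (𝓕 : Set (EuclideanSpace ℝ (Fin n) → Matrix (Fin n) (Fin n) ℝ)) (k : ℝ) : Prop :=
  IsLUB (liouvilleExponents 𝓕) k

end Liouville

/-! Let `u` be a solution, `e = A∇u·∇u`, `P = A∇u·x`, `Q = x₀∂₁u - x₁∂₀u` (the angular derivative)
and `α = √(lam/L)`. Testing the equation with `uη`, where `η` is radial with `∇η = -w x`, gives `∫
ηe = ∫ w u P`. As `A∇u` is divergence free, its flux through circles vanishes, so `P` has mean zero
on almost every circle. There `u` may be replaced by `u` minus its mean, and Young's and Wirtinger's
inequalities bound `∫ uP` by `∫ (κ/2 Q² + 1/(2κ) P²)`. Symmetry and ellipticity give the pointwise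
bound `lam Q² + P²/L ≤ |x|² e`. With `κ = √(lam L)` the two combine into `∫ ηe ≤ 1/(2α) ∫ w|x|² e`
(`integral_test_mul_energy_le`), an integrated form of the monotonicity of `r^(-2α) ∫_{B_r} e`.

For growth `γ < α`, take `γ < a < α` and let `η` be `(1+|x|²)^(-a)` times a cutoff at radius about
`R`. The derivative of the power costs at most `(a/α) ∫ ηe`, which is absorbed. The derivative of
the cutoff costs `R^(-2a)` times the energy at scale `R`, which is `O(R^(2γ))` by Caccioppoli's
inequality. Letting `R → ∞` gives `e = 0` almost everywhere, so the gradient vanishes and `u` is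
constant (`isAEConst_of_hasGrowth`).

The exponent is sharp: with eigenvalue `L` in the radial and `lam` in the angular direction, `r^α
cos θ` is a nonconstant solution, whose stream function is a multiple of `r^α sin θ`
(`isWeakSolution_powCoord`). -/

namespace Liouville

/-! ### Mollification in `L²_loc` and of weak gradients. -/

section Mollification

open Filter Topology Set
open scoped ENNReal Convolution

variable {n : ℕ}

theorem eLpNorm_two_sq {α : Type*} [MeasurableSpace α] (μ : Measure α) (f : α → ℝ) :
    eLpNorm f 2 μ ^ 2 = ∫⁻ x, ‖f x‖ₑ ^ 2 ∂μ := by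
  have h := eLpNorm_nnreal_pow_eq_lintegral (μ := μ) (f := f) (p := 2) (by norm_num)
  simpa using h

/-- Translations are continuous in `L²`. -/
theorem tendsto_eLpNorm_translate_sub {f : EuclideanSpace ℝ (Fin n) → ℝ}
    (hf : MemLp f 2 volume) :
    Tendsto (fun t => eLpNorm (fun x => f (x - t) - f x) 2 volume) (𝓝 0) (𝓝 0) := by
  let g : C(EuclideanSpace ℝ (Fin n), C(EuclideanSpace ℝ (Fin n), EuclideanSpace ℝ (Fin n))) :=
    (ContinuousMap.mk (fun a : EuclideanSpace ℝ (Fin n) × EuclideanSpace ℝ (Fin n) => a.2 - a.1)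
      (by fun_prop)).curry
  have hg : ∀ t, MeasurePreserving (g t) volume volume := fun t =>
    measurePreserving_sub_right volume t
  have h := Tendsto.compMeasurePreservingLp (l := 𝓝 (0 : EuclideanSpace ℝ (Fin n)))
    (f := fun _ => hf.toLp f) (g := g) tendsto_const_nhds (g.continuous.tendsto 0) hg (hg 0)
    (by norm_num)
  rw [Lp.tendsto_Lp_iff_tendsto_eLpNorm'] at h
  refine h.congr fun t => eLpNorm_congr_ae ?_
  have h1 := Lp.coeFn_compMeasurePreserving (hf.toLp f) (hg t)
  have h2 := Lp.coeFn_compMeasurePreserving (hf.toLp f) (hg 0)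
  have h3 := hf.coeFn_toLp
  have h4 := (hg t).quasiMeasurePreserving.tendsto_ae.eventually h3
  have h5 := (hg 0).quasiMeasurePreserving.tendsto_ae.eventually h3
  filter_upwards [h1, h2, h4, h5] with x a1 a2 a4 a5
  have e1 : g t x = x - t := rfl
  have e2 : g 0 x = x := by change x - 0 = x; simp
  rw [e1] at a4
  rw [e2] at a5
  simp only [Pi.sub_apply, a1, a2, Function.comp, e1, e2, a4, a5]

/-- The `L²` distance from `f` to its mollification is controlled by its translates. -/
theorem eLpNorm_convolution_sub_le {f : EuclideanSpace ℝ (Fin n) → ℝ}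
    (hf : MemLp f 2 volume) (ρ : ContDiffBump (0 : EuclideanSpace ℝ (Fin n))) {ε : ℝ≥0∞}
    (hε : ∀ t ∈ Metric.ball (0 : EuclideanSpace ℝ (Fin n)) ρ.rOut,
      eLpNorm (fun x => f (x - t) - f x) 2 volume ≤ ε) :
    eLpNorm (fun x => (ρ.normed volume ⋆[ContinuousLinearMap.lsmul ℝ ℝ, volume] f) x - f x)
      2 volume ≤ ε := by
  -- The bump is the density of a probability measure `ν`, so the mollification error is a
  -- `ν`-average of `f (x - t) - f x`. Comparing the `L¹(ν)` and `L²(ν)` norms bounds its square;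
  -- Tonelli then integrates in `x`.
  set k : EuclideanSpace ℝ (Fin n) → ℝ≥0∞ := fun t => ENNReal.ofReal (ρ.normed volume t) with hk
  have hkm : Measurable k := (ρ.continuous_normed.measurable).ennreal_ofReal
  set ν : Measure (EuclideanSpace ℝ (Fin n)) := volume.withDensity k with hν
  have hkint : ∫⁻ t, k t = 1 := by
    rw [← ofReal_integral_eq_lintegral_ofReal ρ.integrable_normed
      (Eventually.of_forall ρ.nonneg_normed), ρ.integral_normed, ENNReal.ofReal_one]
  have : IsProbabilityMeasure ν := ⟨by simp [hν, withDensity_apply, hkint]⟩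
  have hloc : LocallyIntegrable f volume := hf.locallyIntegrable (by norm_num)
  have hpair : AEStronglyMeasurable (fun p : EuclideanSpace ℝ (Fin n) × EuclideanSpace ℝ (Fin n) =>
      f (p.1 - p.2) - f p.1) (volume.prod volume) :=
    (hf.1.comp_quasiMeasurePreserving (quasiMeasurePreserving_sub volume volume)).sub hf.1.comp_fst
  have hsec : ∀ x, AEStronglyMeasurable (fun t => f (x - t) - f x) volume := fun x =>
    (hf.1.comp_quasiMeasurePreserving
      (quasiMeasurePreserving_sub_left_of_right_invariant volume x)).sub
      aestronglyMeasurable_const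
  have hpt : ∀ x, ‖(ρ.normed volume ⋆[ContinuousLinearMap.lsmul ℝ ℝ, volume] f) x - f x‖ₑ ^ 2 ≤
      ∫⁻ t, k t * ‖f (x - t) - f x‖ₑ ^ 2 := by
    intro x
    have e1 : (ρ.normed volume ⋆[ContinuousLinearMap.lsmul ℝ ℝ, volume] f) x - f x =
        ∫ t, ρ.normed volume t * (f (x - t) - f x) := by
      have hex : Integrable (fun t => ρ.normed volume t * f (x - t)) := by
        have := (ρ.hasCompactSupport_normed (μ := volume)).convolutionExists_left
          (ContinuousLinearMap.lsmul ℝ ℝ) ρ.continuous_normed hloc x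
        simpa [ConvolutionExistsAt] using this
      simp_rw [mul_sub]
      rw [integral_sub hex (ρ.integrable_normed.mul_const _), integral_mul_const,
        ρ.integral_normed, one_mul]
      rfl
    have e2 : ‖∫ t, ρ.normed volume t * (f (x - t) - f x)‖ₑ ≤ ∫⁻ t, ‖f (x - t) - f x‖ₑ ∂ν := by
      refine (enorm_integral_le_lintegral_enorm _).trans ?_
      rw [hν, lintegral_withDensity_eq_lintegral_mul₀ hkm.aemeasurable (hsec x).enorm]
      refine lintegral_mono fun t => ?_
      simp only [Pi.mul_apply, hk, enorm_mul]
      rw [Real.enorm_of_nonneg (ρ.nonneg_normed t)]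
    have e3 : ∫⁻ t, ‖f (x - t) - f x‖ₑ ∂ν ≤ eLpNorm (fun t => f (x - t) - f x) 2 ν := by
      rw [← eLpNorm_one_eq_lintegral_enorm]
      exact eLpNorm_le_eLpNorm_of_exponent_le (by norm_num)
        ((hsec x).mono_ac (withDensity_absolutelyContinuous _ _))
    calc _ ≤ eLpNorm (fun t => f (x - t) - f x) 2 ν ^ 2 := by
          rw [e1]; exact pow_le_pow_left₀ (zero_le) (e2.trans e3) 2
      _ = _ := by
          rw [eLpNorm_two_sq, hν, lintegral_withDensity_eq_lintegral_mul₀ hkm.aemeasurable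
            ((hsec x).enorm.pow_const 2)]
          rfl
  have hmain : eLpNorm (fun x => (ρ.normed volume ⋆[ContinuousLinearMap.lsmul ℝ ℝ, volume] f) x
      - f x) 2 volume ^ 2 ≤ ε ^ 2 := by
    rw [eLpNorm_two_sq]
    calc _ ≤ ∫⁻ x, ∫⁻ t, k t * ‖f (x - t) - f x‖ₑ ^ 2 := lintegral_mono hpt
      _ = ∫⁻ t, ∫⁻ x, k t * ‖f (x - t) - f x‖ₑ ^ 2 := by
          refine lintegral_lintegral_swap ?_
          exact (hkm.comp measurable_snd).aemeasurable.mul (hpair.enorm.pow_const 2)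
      _ ≤ ∫⁻ t, k t * ε ^ 2 := by
          refine lintegral_mono fun t => ?_
          rw [lintegral_const_mul' _ _ (by simp [hk]), ← eLpNorm_two_sq]
          by_cases ht : t ∈ Metric.ball (0 : EuclideanSpace ℝ (Fin n)) ρ.rOut
          · gcongr; exact hε t ht
          · have : ρ.normed volume t = 0 := by
              rw [← ρ.support_normed_eq (μ := volume)] at ht
              simpa using ht
            simp [hk, this]
      _ = ε ^ 2 := by rw [lintegral_mul_const _ hkm, hkint, one_mul]
  exact (ENNReal.pow_le_pow_left_iff two_ne_zero).1 hmain

theorem MemL2loc.aestronglyMeasurable {F : Type*} [NormedAddCommGroup F]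
    {f : EuclideanSpace ℝ (Fin n) → F} (hf : MemL2loc f) : AEStronglyMeasurable f volume := by
  have h : AEStronglyMeasurable f (volume.restrict
      (⋃ k : ℕ, Metric.closedBall (0 : EuclideanSpace ℝ (Fin n)) k)) :=
    aestronglyMeasurable_iUnion_iff.2 fun k => (hf _ (isCompact_closedBall _ _)).1
  rwa [Metric.iUnion_closedBall_nat, Measure.restrict_univ] at h

theorem MemL2loc.locallyIntegrable {F : Type*} [NormedAddCommGroup F]
    {f : EuclideanSpace ℝ (Fin n) → F} (hf : MemL2loc f) : LocallyIntegrable f volume := by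
  rw [locallyIntegrable_iff]
  intro K hK
  have : IsFiniteMeasure (volume.restrict K) := ⟨by simpa using hK.measure_lt_top⟩
  exact (hf K hK).integrable (by norm_num)

/-- The standard mollifier of radius comparable to `1 / k`. -/
noncomputable def mollifier (n k : ℕ) : ContDiffBump (0 : EuclideanSpace ℝ (Fin n)) where
  rIn := 1 / (2 * ((k : ℝ) + 1))
  rOut := 1 / ((k : ℝ) + 1)
  rIn_pos := by positivity
  rIn_lt_rOut := by
    apply one_div_lt_one_div_of_lt (by positivity)
    have : (0 : ℝ) ≤ k := by positivity
    linarith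

theorem tendsto_mollifier_rOut : Tendsto (fun k => (mollifier n k).rOut) atTop (𝓝 0) :=
  tendsto_one_div_add_atTop_nhds_zero_nat

/-- The mollification of a function. -/
noncomputable def mollify (f : EuclideanSpace ℝ (Fin n) → ℝ) (k : ℕ) :
    EuclideanSpace ℝ (Fin n) → ℝ :=
  (mollifier n k).normed volume ⋆[ContinuousLinearMap.lsmul ℝ ℝ, volume] f

theorem tendsto_mollify_ae {f : EuclideanSpace ℝ (Fin n) → ℝ} (hf : LocallyIntegrable f volume) :
    ∀ᵐ x, Tendsto (fun k => mollify f k x) atTop (𝓝 (f x)) := by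
  -- The bound `K = 2` is the ratio `rOut / rIn` of `mollifier`.
  refine ContDiffBump.ae_convolution_tendsto_right_of_locallyIntegrable (K := 2)
    tendsto_mollifier_rOut (Eventually.of_forall fun k => le_of_eq ?_) hf
  have : (k : ℝ) + 1 ≠ 0 := by positivity
  simp only [mollifier]
  field_simp

theorem contDiff_mollify {f : EuclideanSpace ℝ (Fin n) → ℝ} (hf : LocallyIntegrable f volume)
    (k : ℕ) : ContDiff ℝ ∞ (mollify f k) :=
  ((mollifier n k).hasCompactSupport_normed).contDiff_convolution_left _
    (mollifier n k).contDiff_normed hf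

/-- The mollification radii are at most `1`, so on `K` the mollification only sees `f` on the unit
thickening of `K`. Cutting `f` off there reduces the claim to a global `L²` function. -/
theorem tendsto_mollify_eLpNorm {f : EuclideanSpace ℝ (Fin n) → ℝ} (hf : MemL2loc f)
    {K : Set (EuclideanSpace ℝ (Fin n))} (hK : IsCompact K) :
    Tendsto (fun k => eLpNorm (fun x => mollify f k x - f x) 2 (volume.restrict K)) atTop
      (𝓝 0) := by
  set K' := Metric.cthickening 1 K
  have hK' : IsCompact K' := hK.cthickening
  set f' := K'.indicator f
  have hf' : MemLp f' 2 volume :=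
    (memLp_indicator_iff_restrict hK'.isClosed.measurableSet).2 (hf K' hK')
  have hball : ∀ k : ℕ, (mollifier n k).rOut ≤ 1 := fun k => by
    simp only [mollifier]
    rw [div_le_one (by positivity)]
    linarith [(Nat.cast_nonneg k : (0 : ℝ) ≤ k)]
  have hconv : Tendsto (fun k => eLpNorm (fun x => mollify f' k x - f' x) 2 volume) atTop
      (𝓝 0) := by
    rw [ENNReal.tendsto_nhds_zero]
    intro ε hε
    obtain ⟨δ, hδ, hb⟩ := Metric.eventually_nhds_iff_ball.1
      ((ENNReal.tendsto_nhds_zero.1 (tendsto_eLpNorm_translate_sub hf')) ε hε)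
    filter_upwards [tendsto_mollifier_rOut.eventually (gt_mem_nhds hδ)] with k hk
    exact eLpNorm_convolution_sub_le hf' _ fun t ht => hb t (Metric.ball_subset_ball hk.le ht)
  refine tendsto_of_tendsto_of_tendsto_of_le_of_le tendsto_const_nhds hconv
    (fun _ => zero_le) fun k => ?_
  refine le_trans (le_of_eq ?_) (eLpNorm_restrict_le _ 2 volume K)
  refine eLpNorm_congr_ae ?_
  filter_upwards [ae_restrict_mem hK.isClosed.measurableSet] with x hx
  have hxx : ∀ t ∈ Metric.ball (0 : EuclideanSpace ℝ (Fin n)) (mollifier n k).rOut,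
      f' (x - t) = f (x - t) := by
    intro t ht
    refine indicator_of_mem (Metric.mem_cthickening_of_dist_le _ x _ _ hx ?_) _
    have := (mem_ball_zero_iff.1 ht).le.trans (hball k)
    simpa [dist_eq_norm] using this
  congr 1
  · simp only [mollify, convolution_def]
    refine integral_congr_ae (Eventually.of_forall fun t => ?_)
    by_cases ht : t ∈ Metric.ball (0 : EuclideanSpace ℝ (Fin n)) (mollifier n k).rOut
    · simp only [hxx t ht]
    · have : (mollifier n k).normed volume t = 0 := by
        rw [← (mollifier n k).support_normed_eq (μ := volume)] at ht
        simpa using ht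
      simp [this]
  · have := hxx 0 (Metric.mem_ball_self (mollifier n k).rOut_pos)
    simpa using this.symm

theorem gradient_apply {f : EuclideanSpace ℝ (Fin n) → ℝ} (x : EuclideanSpace ℝ (Fin n))
    (i : Fin n) : gradient f x i = fderiv ℝ f x (EuclideanSpace.single i 1) := by
  have h := InnerProductSpace.toDual_symm_apply (𝕜 := ℝ) (x := EuclideanSpace.single i (1 : ℝ))
    (y := fderiv ℝ f x)
  rw [← h, EuclideanSpace.inner_single_right]
  simp [gradient]

/-- The gradient of the mollification is the mollification of the weak gradient. -/
theorem gradient_mollify {u : EuclideanSpace ℝ (Fin n) → ℝ}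
    {V : EuclideanSpace ℝ (Fin n) → EuclideanSpace ℝ (Fin n)} (h : IsH1locWithGradient u V)
    (k : ℕ) (x : EuclideanSpace ℝ (Fin n)) (i : Fin n) :
    gradient (mollify u k) x i = mollify (fun y => V y i) k x := by
  set ρ := (mollifier n k).normed volume with hρ
  have hρs : ContDiff ℝ ∞ ρ := (mollifier n k).contDiff_normed
  have hρc : HasCompactSupport ρ := (mollifier n k).hasCompactSupport_normed
  have h1 := hρc.hasFDerivAt_convolution_left (ContinuousLinearMap.lsmul ℝ ℝ)
    (μ := volume) (hρs.of_le (by simp)) h.1.locallyIntegrable x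
  have hint : Integrable (fun t => ContinuousLinearMap.precompL (EuclideanSpace ℝ (Fin n))
      (ContinuousLinearMap.lsmul ℝ ℝ) (fderiv ℝ ρ t) (u (x - t))) volume :=
    (hρc.fderiv (𝕜 := ℝ)).convolutionExists_left _
      (hρs.continuous_fderiv (by simp)) h.1.locallyIntegrable x
  rw [gradient_apply, mollify, h1.fderiv, convolution_def, ContinuousLinearMap.integral_apply hint,
    mollify, convolution_eq_swap]
  -- The weak gradient is tested with the reflected, translated bump; the sign from the inner
  -- derivative cancels the one from integration by parts.
  have hφ : IsTestFunction (fun t => ρ (x - t)) :=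
    ⟨hρs.comp (contDiff_const.sub contDiff_id),
      hρc.comp_homeomorph (Homeomorph.subLeft x)⟩
  have hg : ∀ t, gradient (fun t => ρ (x - t)) t i =
      -(fderiv ℝ ρ (x - t) (EuclideanSpace.single i 1)) := by
    intro t
    have hd := ((hρs.differentiable (by simp)) (x - t)).hasFDerivAt.comp t
      ((hasFDerivAt_const x t).sub (hasFDerivAt_id t))
    rw [gradient_apply, HasFDerivAt.fderiv (f := fun t => ρ (x - t)) hd]
    simp
  have hw := h.2.2 _ hφ i
  simp_rw [hg] at hw
  rw [← integral_sub_left_eq_self _ volume x]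
  simp only [ContinuousLinearMap.precompL_apply, ContinuousLinearMap.lsmul_apply, smul_eq_mul,
    sub_sub_cancel]
  calc _ = - ∫ t, u t * -(fderiv ℝ ρ (x - t) (EuclideanSpace.single i 1)) := by
        rw [← integral_neg]; congr 1; ext t; ring
    _ = _ := by rw [hw, neg_neg]; congr 1; ext t; ring

/-- An `H¹_loc` function with vanishing weak gradient is constant. -/
theorem isAEConst_of_gradient_ae_zero {u : EuclideanSpace ℝ (Fin n) → ℝ}
    {V : EuclideanSpace ℝ (Fin n) → EuclideanSpace ℝ (Fin n)} (h : IsH1locWithGradient u V)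
    (hV : V =ᵐ[volume] 0) : IsAEConst u := by
  -- Each mollification is smooth with zero gradient, hence constant; `u` is their almost everywhere
  -- limit.
  have hz : ∀ k x, mollify u k x = mollify u k 0 := by
    intro k x
    refine is_const_of_fderiv_eq_zero
      ((contDiff_mollify h.1.locallyIntegrable k).differentiable (by simp)) (fun y => ?_) x 0
    have hg : gradient (mollify u k) y = 0 := by
      ext i
      rw [gradient_mollify h, mollify]
      have : (fun y => V y i) =ᵐ[volume] (0 : EuclideanSpace ℝ (Fin n) → ℝ) := by
        filter_upwards [hV] with z hz
        simp [hz]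
      rw [convolution_congr _ (ae_eq_refl _) this]
      simp
    simpa [gradient] using hg
  have hae := tendsto_mollify_ae h.1.locallyIntegrable
  obtain ⟨x₀, hx₀⟩ := hae.exists
  refine ⟨u x₀, ?_⟩
  filter_upwards [hae] with x hx
  exact tendsto_nhds_unique hx (hx₀.congr fun k => by rw [hz k x, hz k x₀])

end Mollification

/-! ### Calculus in `L²_loc` and testing an equation with `H¹_loc` functions. -/

section LocalSquareIntegrability

open Filter Topology Set
open scoped ENNReal

variable {n : ℕ}

theorem tendsto_integral_mul_of_tendsto_eLpNorm {α : Type*} [MeasurableSpace α] {μ : Measure α}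
    {f g : α → ℝ} {fk gk : ℕ → α → ℝ} (hf : MemLp f 2 μ) (hg : MemLp g 2 μ)
    (hfk : ∀ k, MemLp (fk k) 2 μ) (hgk : ∀ k, MemLp (gk k) 2 μ)
    (hft : Tendsto (fun k => eLpNorm (fun x => fk k x - f x) 2 μ) atTop (𝓝 0))
    (hgt : Tendsto (fun k => eLpNorm (fun x => gk k x - g x) 2 μ) atTop (𝓝 0)) :
    Tendsto (fun k => ∫ x, fk k x * gk k x ∂μ) atTop (𝓝 (∫ x, f x * g x ∂μ)) := by
  have h1 := (Lp.tendsto_Lp_iff_tendsto_eLpNorm'' fk hfk f hf).2 hft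
  have h2 := (Lp.tendsto_Lp_iff_tendsto_eLpNorm'' gk hgk g hg).2 hgt
  have h3 := h1.inner (𝕜 := ℝ) h2
  have key : ∀ {a b : α → ℝ} (ha : MemLp a 2 μ) (hb : MemLp b 2 μ),
      inner ℝ (ha.toLp a) (hb.toLp b) = ∫ x, a x * b x ∂μ := by
    intro a b ha hb
    rw [L2.inner_def]
    refine integral_congr_ae ?_
    filter_upwards [ha.coeFn_toLp, hb.coeFn_toLp] with x hx hy
    rw [hx, hy]
    simp [mul_comm]
  simpa only [key] using h3

theorem MemL2loc.bdd_mul {f g : EuclideanSpace ℝ (Fin n) → ℝ} (hf : MemL2loc f)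
    (hg : AEStronglyMeasurable g volume)
    (hb : ∀ K : Set (EuclideanSpace ℝ (Fin n)), IsCompact K → ∃ C, ∀ x ∈ K, |g x| ≤ C) :
    MemL2loc (fun x => g x * f x) := by
  intro K hK
  obtain ⟨C, hC⟩ := hb K hK
  refine ((hf K hK).const_mul C).mono (hg.restrict.mul (hf K hK).1) ?_
  filter_upwards [ae_restrict_mem hK.isClosed.measurableSet] with x hx
  rw [norm_mul, norm_mul]
  gcongr
  exact (hC x hx).trans (le_abs_self C)

theorem MemL2loc.continuous_mul {f g : EuclideanSpace ℝ (Fin n) → ℝ} (hf : MemL2loc f)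
    (hg : Continuous g) : MemL2loc (fun x => g x * f x) :=
  hf.bdd_mul hg.aestronglyMeasurable fun K hK => by
    simpa using hK.exists_bound_of_continuousOn hg.continuousOn

theorem MemL2loc.add {f g : EuclideanSpace ℝ (Fin n) → ℝ} (hf : MemL2loc f) (hg : MemL2loc g) :
    MemL2loc (fun x => f x + g x) :=
  fun K hK => (hf K hK).add (hg K hK)

theorem MemL2loc.sum {ι : Type*} (s : Finset ι) {f : ι → EuclideanSpace ℝ (Fin n) → ℝ}
    (hf : ∀ i ∈ s, MemL2loc (f i)) : MemL2loc (fun x => ∑ i ∈ s, f i x) :=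
  fun K hK => memLp_finsetSum s fun i hi => hf i hi K hK

theorem memL2loc_of_continuous {f : EuclideanSpace ℝ (Fin n) → ℝ} (hf : Continuous f) :
    MemL2loc f := by
  intro K hK
  have : IsFiniteMeasure (volume.restrict K) := ⟨by simpa using hK.measure_lt_top⟩
  obtain ⟨C, hC⟩ := hK.exists_bound_of_continuousOn hf.continuousOn
  exact MemLp.of_bound hf.aestronglyMeasurable C
    ((ae_restrict_iff' hK.isClosed.measurableSet).2 (Eventually.of_forall hC))

theorem MemL2loc.coord {V : EuclideanSpace ℝ (Fin n) → EuclideanSpace ℝ (Fin n)}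
    (hV : MemL2loc V) (i : Fin n) : MemL2loc (fun x => V x i) := by
  intro K hK
  refine (hV K hK).mono ?_ (Eventually.of_forall fun x => PiLp.norm_apply_le (V x) i)
  exact ((EuclideanSpace.proj (𝕜 := ℝ) i).continuous.comp_aestronglyMeasurable (hV K hK).1)

theorem MemL2loc.locallyIntegrable_mul {f g : EuclideanSpace ℝ (Fin n) → ℝ} (hf : MemL2loc f)
    (hg : MemL2loc g) : LocallyIntegrable (fun x => f x * g x) volume := by
  rw [locallyIntegrable_iff]
  intro K hK
  exact (hf K hK).integrable_mul (hg K hK)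

theorem integrable_continuous_mul {ψ h : EuclideanSpace ℝ (Fin n) → ℝ} (hψ : Continuous ψ)
    (hc : HasCompactSupport ψ) (hh : LocallyIntegrable h volume) :
    Integrable (fun x => ψ x * h x) volume := by
  simpa using hh.integrable_smul_left_of_hasCompactSupport hψ hc

theorem continuous_gradient_apply {ψ : EuclideanSpace ℝ (Fin n) → ℝ} (hψ : ContDiff ℝ ∞ ψ)
    (i : Fin n) : Continuous (fun x => gradient ψ x i) := by
  simp_rw [gradient_apply]
  exact (hψ.continuous_fderiv (by simp)).clm_apply continuous_const

theorem gradient_eq_zero_of_notMem_tsupport {ψ : EuclideanSpace ℝ (Fin n) → ℝ}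
    {x : EuclideanSpace ℝ (Fin n)} (hx : x ∉ tsupport ψ) (i : Fin n) : gradient ψ x i = 0 := by
  rw [gradient_apply, fderiv_of_notMem_tsupport ℝ hx]
  simp

theorem hasCompactSupport_gradient_apply {ψ : EuclideanSpace ℝ (Fin n) → ℝ}
    (hψ : HasCompactSupport ψ) (i : Fin n) : HasCompactSupport (fun x => gradient ψ x i) :=
  HasCompactSupport.intro hψ fun _ hx => gradient_eq_zero_of_notMem_tsupport hx i

theorem gradient_mul_apply {f g : EuclideanSpace ℝ (Fin n) → ℝ} {x : EuclideanSpace ℝ (Fin n)}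
    (hf : DifferentiableAt ℝ f x) (hg : DifferentiableAt ℝ g x) (i : Fin n) :
    gradient (fun y => f y * g y) x i = g x * gradient f x i + f x * gradient g x i := by
  simp_rw [gradient_apply]
  rw [fderiv_fun_mul hf hg]
  simp [add_comm]

/-- A weakly divergence free field can be tested with `u ψ`, for `u` in `H¹_loc`. -/
theorem integral_flux_mul_test_eq_zero {u : EuclideanSpace ℝ (Fin n) → ℝ}
    {V : EuclideanSpace ℝ (Fin n) → EuclideanSpace ℝ (Fin n)} (h : IsH1locWithGradient u V)
    {F : EuclideanSpace ℝ (Fin n) → Fin n → ℝ} (hF : ∀ i, MemL2loc (fun x => F x i))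
    (hdiv : ∀ φ : EuclideanSpace ℝ (Fin n) → ℝ, IsTestFunction φ →
      ∫ x, F x ⬝ᵥ (gradient φ x).ofLp = 0)
    {ψ : EuclideanSpace ℝ (Fin n) → ℝ} (hψ : IsTestFunction ψ) :
    (∫ x, ψ x * (F x ⬝ᵥ (V x).ofLp)) + ∫ x, u x * (F x ⬝ᵥ (gradient ψ x).ofLp) = 0 := by
  set K := tsupport ψ
  have hK : IsCompact K := hψ.2
  have hum : ∀ k, ContDiff ℝ ∞ (mollify u k) := contDiff_mollify h.1.locallyIntegrable
  have hA : ∀ i, MemLp (fun x => ψ x * F x i) 2 (volume.restrict K) := fun i =>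
    (hF i).continuous_mul hψ.1.continuous K hK
  have hB : ∀ i, MemLp (fun x => gradient ψ x i * F x i) 2 (volume.restrict K) := fun i =>
    (hF i).continuous_mul (continuous_gradient_apply hψ.1 i) K hK
  have hmV : ∀ i k, MemLp (fun x => gradient (mollify u k) x i) 2 (volume.restrict K) :=
    fun i k => memL2loc_of_continuous (continuous_gradient_apply (hum k) i) K hK
  have hmu : ∀ k, MemLp (mollify u k) 2 (volume.restrict K) :=
    fun k => memL2loc_of_continuous (hum k).continuous K hK
  -- For the mollified `u` the product with `ψ` is a genuine test function, so the expression is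
  -- zero for every `k`. Everything lives on the compact support of `ψ`, where `L²` convergence
  -- allows passing to the limit.
  have hlim : Tendsto (fun k => ∑ i, ((∫ x in K, (ψ x * F x i) * gradient (mollify u k) x i) +
        ∫ x in K, (gradient ψ x i * F x i) * mollify u k x)) atTop
      (𝓝 (∑ i, ((∫ x in K, (ψ x * F x i) * V x i) +
        ∫ x in K, (gradient ψ x i * F x i) * u x))) := by
    refine tendsto_finsetSum _ fun i _ => Tendsto.add ?_ ?_
    · refine tendsto_integral_mul_of_tendsto_eLpNorm (hA i) (h.2.1.coord i K hK) (fun _ => hA i)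
        (hmV i) (by simp) ?_
      simp_rw [gradient_mollify h]
      exact tendsto_mollify_eLpNorm (h.2.1.coord i) hK
    · exact tendsto_integral_mul_of_tendsto_eLpNorm (hB i) (h.1 K hK) (fun _ => hB i)
        hmu (by simp) (tendsto_mollify_eLpNorm h.1 hK)
  have hsum : ∀ (v : EuclideanSpace ℝ (Fin n) → ℝ)
      (W : EuclideanSpace ℝ (Fin n) → EuclideanSpace ℝ (Fin n)),
      MemLp v 2 (volume.restrict K) → (∀ i, MemLp (fun x => W x i) 2 (volume.restrict K)) →
      ∑ i, ((∫ x in K, (ψ x * F x i) * W x i) + ∫ x in K, (gradient ψ x i * F x i) * v x) =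
      (∫ x, ψ x * (F x ⬝ᵥ (W x).ofLp)) + ∫ x, v x * (F x ⬝ᵥ (gradient ψ x).ofLp) := by
    intro v W hv hW
    have hi1 : ∀ i, Integrable (fun x => (ψ x * F x i) * W x i) (volume.restrict K) :=
      fun i => (hA i).integrable_mul (hW i)
    have hi2 : ∀ i, Integrable (fun x => (gradient ψ x i * F x i) * v x) (volume.restrict K) :=
      fun i => (hB i).integrable_mul hv
    rw [Finset.sum_add_distrib, ← integral_finsetSum _ (fun i _ => hi1 i),
      ← integral_finsetSum _ (fun i _ => hi2 i)]
    congr 1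
    · refine Eq.trans ?_ (setIntegral_eq_integral_of_forall_compl_eq_zero (s := K) fun x hx => ?_)
      · simp only [dotProduct, Finset.mul_sum, mul_assoc]
      · simp [image_eq_zero_of_notMem_tsupport hx]
    · refine Eq.trans ?_ (setIntegral_eq_integral_of_forall_compl_eq_zero (s := K) fun x hx => ?_)
      · simp only [dotProduct, Finset.mul_sum]
        congr 1; ext x
        exact Finset.sum_congr rfl fun i _ => by ring
      · simp [dotProduct, gradient_eq_zero_of_notMem_tsupport hx]
  rw [← hsum u V (h.1 K hK) (fun i => h.2.1.coord i K hK)]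
  refine tendsto_nhds_unique hlim (tendsto_const_nhds.congr fun k => ?_)
  rw [hsum _ (gradient (mollify u k)) (hmu k) (fun i => hmV i k)]
  have ht : IsTestFunction (fun x => mollify u k x * ψ x) :=
    ⟨(hum k).mul hψ.1, hψ.2.mul_left⟩
  rw [← hdiv _ ht, ← integral_add]
  · congr 1; ext x
    have hg : (gradient (fun y => mollify u k y * ψ y) x).ofLp = fun i =>
        ψ x * gradient (mollify u k) x i + mollify u k x * gradient ψ x i := by
      ext i
      exact gradient_mul_apply ((hum k).differentiable (by simp) x)
        (hψ.1.differentiable (by simp) x) i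
    rw [hg]
    simp only [dotProduct, Finset.mul_sum, ← Finset.sum_add_distrib]
    exact Finset.sum_congr rfl fun i _ => by ring
  · refine integrable_continuous_mul hψ.1.continuous hψ.2 ?_
    simp only [dotProduct]
    refine locallyIntegrable_finsetSum _ fun i _ => ?_
    exact (hF i).locallyIntegrable_mul
      (memL2loc_of_continuous (continuous_gradient_apply (hum k) i))
  · simp only [dotProduct, Finset.mul_sum]
    refine integrable_finsetSum _ fun i _ => ?_
    have := integrable_continuous_mul (continuous_gradient_apply hψ.1 i)
      (hasCompactSupport_gradient_apply hψ.2 i) ((hF i).continuous_mul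
        (hum k).continuous).locallyIntegrable
    exact this.congr (Eventually.of_forall fun x => by ring)

end LocalSquareIntegrability

/-! ### Wirtinger's inequality on the circle. -/

section Wirtinger

open Filter Topology Set Real

/-- Wirtinger's inequality on an interval of length `2π`. -/
theorem integral_sq_le_integral_deriv_sq {g g' : ℝ → ℝ} (hg : ∀ x, HasDerivAt g (g' x) x)
    (hg' : Continuous g') (hper : g (-π) = g π) (hmean : ∫ x in (-π)..π, g x = 0) :
    ∫ x in (-π)..π, g x ^ 2 ≤ ∫ x in (-π)..π, g' x ^ 2 := by
  have hab : -π < π := by linarith [pi_pos]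
  have hgc : Continuous g := continuous_iff_continuousAt.2 fun x => (hg x).continuousAt
  have hmem : ∀ f : ℝ → ℝ, Continuous f →
      MemLp (fun x => (f x : ℂ)) 2 (volume.restrict (Ioc (-π) π)) := by
    intro f hf
    have hf' : Continuous (fun x => (f x : ℂ)) := by fun_prop
    obtain ⟨C, hC⟩ := (isCompact_Icc (a := -π) (b := π)).exists_bound_of_continuousOn
      hf'.continuousOn
    exact MemLp.of_bound hf'.aestronglyMeasurable C
      ((ae_restrict_iff' measurableSet_Ioc).2
        (Eventually.of_forall fun x hx => hC x (Ioc_subset_Icc_self hx)))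
  -- Parseval reduces the inequality to single Fourier modes. Mode `0` of `g` vanishes by the mean
  -- condition; in mode `i ≠ 0` periodicity kills the boundary term and the coefficient of `g` is
  -- that of `g'` divided by `i` up to a phase.
  have h1 := hasSum_sq_fourierCoeffOn hab (hmem g hgc)
  have h2 := hasSum_sq_fourierCoeffOn hab (hmem g' hg')
  have hle := hasSum_le (fun i => ?_) h1 h2
  · have hpos : 0 < (π - -π)⁻¹ := inv_pos.2 (by linarith [pi_pos])
    simpa [smul_eq_mul, hpos] using le_of_mul_le_mul_left hle hpos
  · rcases eq_or_ne i 0 with rfl | hi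
    · have : fourierCoeffOn hab (fun x => (g x : ℂ)) 0 = 0 := by
        rw [fourierCoeffOn_eq_integral]
        simp only [neg_zero, fourier_zero, one_smul]
        rw [intervalIntegral.integral_ofReal, hmean]
        simp
      rw [this, norm_zero, zero_pow two_ne_zero]
      exact sq_nonneg _
    · have := fourierCoeffOn_of_hasDerivAt hab (f := fun x => (g x : ℂ))
        (f' := fun x => (g' x : ℂ)) hi (fun x _ => (hg x).ofReal_comp)
        (Continuous.intervalIntegrable (by fun_prop) _ _)
      rw [this, hper]
      have h1i : (1 : ℝ) ≤ |(i : ℝ)| := by exact_mod_cast Int.one_le_abs hi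
      have hπ : |π| = π := abs_of_pos pi_pos
      gcongr
      simp only [sub_self, mul_zero, zero_sub, norm_mul, norm_neg, norm_div, norm_one,
        Complex.norm_real, Complex.norm_I, Complex.norm_intCast, RCLike.norm_ofNat,
        mul_one]
      rw [← Complex.ofReal_sub, Complex.norm_real, norm_eq_abs, norm_eq_abs, hπ,
        sub_neg_eq_add, abs_of_pos (show (0 : ℝ) < π + π by linarith [pi_pos])]
      rw [← mul_assoc]
      refine mul_le_of_le_one_left (norm_nonneg _) ?_
      rw [one_div, ← two_mul, inv_mul_le_iff₀ (by positivity)]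
      nlinarith [pi_pos]

/-- As `P` has mean zero, `g` may be replaced by `g` minus its mean `c`; then Young's inequality
with parameter `κ` and Wirtinger's inequality apply. -/
theorem integral_mul_le_of_integral_eq_zero {g g' P : ℝ → ℝ} (hg : ∀ x, HasDerivAt g (g' x) x)
    (hg' : Continuous g') (hper : g (-π) = g π) (hP : MemLp P 2 (volume.restrict (Ioo (-π) π)))
    (hmean : ∫ θ in Ioo (-π) π, P θ = 0) {κ : ℝ} (hκ : 0 < κ) :
    ∫ θ in Ioo (-π) π, g θ * P θ ≤
      ∫ θ in Ioo (-π) π, (κ / 2 * g' θ ^ 2 + 1 / (2 * κ) * P θ ^ 2) := by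
  have hab : -π ≤ π := by linarith [pi_pos]
  have hgc : Continuous g := continuous_iff_continuousAt.2 fun x => (hg x).continuousAt
  have hcint : ∀ f : ℝ → ℝ, Continuous f → IntegrableOn f (Ioo (-π) π) := fun f hf =>
    (hf.integrableOn_Icc (a := -π) (b := π)).mono_set Ioo_subset_Icc_self
  have hcm : ∀ f : ℝ → ℝ, Continuous f → MemLp f 2 (volume.restrict (Ioo (-π) π)) := fun f hf =>
    (memLp_two_iff_integrable_sq hf.aestronglyMeasurable).2 (hcint _ (hf.pow 2))
  have hPi : IntegrableOn P (Ioo (-π) π) := hP.integrable (by norm_num)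
  have hP2 : IntegrableOn (fun θ => P θ ^ 2) (Ioo (-π) π) := hP.integrable_sq
  set c : ℝ := (∫ x in (-π)..π, g x) / (2 * π) with hc
  have hw : ∫ x in (-π)..π, (g x - c) ^ 2 ≤ ∫ x in (-π)..π, g' x ^ 2 := by
    refine integral_sq_le_integral_deriv_sq (fun x => (hg x).sub_const c) hg' (by rw [hper]) ?_
    rw [intervalIntegral.integral_sub (hgc.intervalIntegrable _ _) (by simp)]
    simp only [intervalIntegral.integral_const, smul_eq_mul, hc]
    field_simp [pi_ne_zero]
    ring
  rw [intervalIntegral.integral_of_le hab, intervalIntegral.integral_of_le hab,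
    integral_Ioc_eq_integral_Ioo, integral_Ioc_eq_integral_Ioo] at hw
  have hg0 : IntegrableOn (fun θ => (g θ - c) ^ 2) (Ioo (-π) π) := hcint _ (by fun_prop)
  have hg2 : IntegrableOn (fun θ => g' θ ^ 2) (Ioo (-π) π) := hcint _ (by fun_prop)
  have hgP : IntegrableOn (fun θ => g θ * P θ) (Ioo (-π) π) := (hcm g hgc).integrable_mul hP
  calc ∫ θ in Ioo (-π) π, g θ * P θ = ∫ θ in Ioo (-π) π, (g θ - c) * P θ := by
        simp_rw [sub_mul]
        rw [integral_sub hgP (hPi.const_mul c), integral_const_mul, hmean]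
        simp
    _ ≤ ∫ θ in Ioo (-π) π, (κ / 2 * (g θ - c) ^ 2 + 1 / (2 * κ) * P θ ^ 2) := by
        refine integral_mono ((hgP.sub (hPi.const_mul c)).congr
          (Eventually.of_forall fun θ => ?_)) ((hg0.const_mul _).add (hP2.const_mul _)) fun θ => ?_
        · simp only [Pi.sub_apply]; ring
        · have h : κ / 2 * (g θ - c) ^ 2 + 1 / (2 * κ) * P θ ^ 2 - (g θ - c) * P θ =
              1 / (2 * κ) * (κ * (g θ - c) - P θ) ^ 2 := by field_simp; ring
          have : 0 ≤ 1 / (2 * κ) * (κ * (g θ - c) - P θ) ^ 2 := by positivity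
          show (g θ - c) * P θ ≤ κ / 2 * (g θ - c) ^ 2 + 1 / (2 * κ) * P θ ^ 2
          linarith
    _ ≤ _ := by
        rw [integral_add (hg0.const_mul _) (hP2.const_mul _),
          integral_add (hg2.const_mul _) (hP2.const_mul _), integral_const_mul,
          integral_const_mul (κ / 2)]
        gcongr

end Wirtinger

/-! ### Polar coordinates and integration over circles. -/

section PolarCoordinates

open Filter Topology Set Real

/-- The point of the plane with given polar coordinates. -/
noncomputable def polarPoint (p : ℝ × ℝ) : EuclideanSpace ℝ (Fin 2) :=
  !₂[p.1 * cos p.2, p.1 * sin p.2]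

@[simp] theorem polarPoint_zero (p : ℝ × ℝ) : polarPoint p 0 = p.1 * cos p.2 := rfl
@[simp] theorem polarPoint_one (p : ℝ × ℝ) : polarPoint p 1 = p.1 * sin p.2 := rfl

theorem norm_sq_eq (x : EuclideanSpace ℝ (Fin 2)) : ‖x‖ ^ 2 = x 0 ^ 2 + x 1 ^ 2 := by
  rw [EuclideanSpace.norm_sq_eq]; simp [Fin.sum_univ_two]

theorem norm_polarPoint {r : ℝ} (hr : 0 ≤ r) (θ : ℝ) : ‖polarPoint (r, θ)‖ = r := by
  have h := norm_sq_eq (polarPoint (r, θ))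
  have h2 : ‖polarPoint (r, θ)‖ ^ 2 = r ^ 2 := by
    rw [h]; simp; nlinarith [sin_sq_add_cos_sq θ]
  exact (pow_left_inj₀ (norm_nonneg _) hr two_ne_zero).1 h2

/-- The measurable equivalence between `ℝ × ℝ` and the Euclidean plane. -/
noncomputable def prodEquivPlane : ℝ × ℝ ≃ᵐ EuclideanSpace ℝ (Fin 2) :=
  MeasurableEquiv.finTwoArrow.symm.trans (MeasurableEquiv.toLp 2 (Fin 2 → ℝ))

theorem measurePreserving_prodEquivPlane : MeasurePreserving prodEquivPlane volume volume :=
  ((volume_preserving_finTwoArrow ℝ).symm _).trans (PiLp.volume_preserving_toLp (Fin 2))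

theorem prodEquivPlane_polarCoord (p : ℝ × ℝ) :
    prodEquivPlane (polarCoord.symm p) = polarPoint p := by
  ext i
  fin_cases i <;> rfl

theorem integral_polarPoint (f : EuclideanSpace ℝ (Fin 2) → ℝ) :
    ∫ p in Ioi (0 : ℝ) ×ˢ Ioo (-π) π, p.1 * f (polarPoint p) = ∫ x, f x := by
  rw [← measurePreserving_prodEquivPlane.integral_comp' f,
    ← integral_comp_polarCoord_symm (fun p => f (prodEquivPlane p))]
  simp only [prodEquivPlane_polarCoord, smul_eq_mul]
  rfl

theorem integrableOn_polarPoint {f : EuclideanSpace ℝ (Fin 2) → ℝ} (hf : Integrable f volume) :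
    IntegrableOn (fun p : ℝ × ℝ => p.1 * f (polarPoint p)) (Ioi (0 : ℝ) ×ˢ Ioo (-π) π) := by
  have h1 : Integrable (fun p => f (prodEquivPlane p)) volume :=
    (measurePreserving_prodEquivPlane.integrable_comp_emb
      prodEquivPlane.measurableEmbedding).2 hf
  have h2 := (integrableOn_image_iff_integrableOn_abs_det_fderiv_smul volume
    (polarCoord.open_target.measurableSet)
    (fun p _ => (hasFDerivAt_polarCoord_symm p).hasFDerivWithinAt) polarCoord.symm.injOn
    (fun p => f (prodEquivPlane p))).1 h1.integrableOn
  refine (integrableOn_congr_fun (fun p hp => ?_) polarCoord.open_target.measurableSet).1 h2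
  rw [det_fderivPolarCoordSymm, abs_of_pos hp.1, prodEquivPlane_polarCoord, smul_eq_mul]

theorem integrable_prod_polarPoint {f : EuclideanSpace ℝ (Fin 2) → ℝ} (hf : Integrable f volume) :
    Integrable (fun p : ℝ × ℝ => p.1 * f (polarPoint p))
      ((volume.restrict (Ioi (0 : ℝ))).prod (volume.restrict (Ioo (-π) π))) := by
  rw [Measure.prod_restrict]
  exact integrableOn_polarPoint hf

theorem integral_eq_integral_polarPoint {f : EuclideanSpace ℝ (Fin 2) → ℝ}
    (hf : Integrable f volume) :
    ∫ x, f x = ∫ r in Ioi (0 : ℝ), r * ∫ θ in Ioo (-π) π, f (polarPoint (r, θ)) := by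
  rw [← integral_polarPoint f, Measure.volume_eq_prod, ← Measure.prod_restrict, integral_prod _
    (integrable_prod_polarPoint hf)]
  simp only [integral_const_mul]

/-- Fubini applies to the truncations of `f` to balls of integer radius; countably many exceptional
null sets of radii remain null. -/
theorem ae_integrableOn_polarPoint {f : EuclideanSpace ℝ (Fin 2) → ℝ}
    (hf : LocallyIntegrable f volume) :
    ∀ᵐ r ∂volume.restrict (Ioi (0 : ℝ)),
      IntegrableOn (fun θ => f (polarPoint (r, θ))) (Ioo (-π) π) := by
  have h : ∀ N : ℕ, ∀ᵐ r ∂volume.restrict (Ioi (0 : ℝ)), Integrable (fun θ =>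
      r * (Metric.closedBall 0 (N : ℝ)).indicator f (polarPoint (r, θ)))
      (volume.restrict (Ioo (-π) π)) := fun N =>
    (integrable_prod_polarPoint ((hf.integrableOn_isCompact (isCompact_closedBall 0 (N : ℝ))
      ).integrable_indicator measurableSet_closedBall)).prod_right_ae
  filter_upwards [ae_all_iff.2 h, ae_restrict_mem measurableSet_Ioi] with r hr hr0
  have hr0' : (0 : ℝ) < r := hr0
  obtain ⟨N, hN⟩ := exists_nat_ge r
  refine ((hr N).const_mul r⁻¹).congr (Eventually.of_forall fun θ => ?_)
  have hmem : polarPoint (r, θ) ∈ Metric.closedBall (0 : EuclideanSpace ℝ (Fin 2)) (N : ℝ) := by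
    rw [mem_closedBall_zero_iff, norm_polarPoint hr0'.le]; exact hN
  simp only [indicator_of_mem hmem]
  field_simp

/-- If the integral of `P` against every smooth radial function vanishes, then `P` has mean zero
on almost every circle. -/
theorem ae_integral_polarPoint_eq_zero {P : EuclideanSpace ℝ (Fin 2) → ℝ}
    (hP : LocallyIntegrable P volume)
    (hrad : ∀ k : ℝ → ℝ, ContDiff ℝ ∞ k → HasCompactSupport k → tsupport k ⊆ Ioi 0 →
      ∫ x, k ‖x‖ * P x = 0) :
    ∀ᵐ r ∂volume.restrict (Ioi (0 : ℝ)), ∫ θ in Ioo (-π) π, P (polarPoint (r, θ)) = 0 := by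
  have hloc : LocallyIntegrableOn (fun r => r * ∫ θ in Ioo (-π) π, P (polarPoint (r, θ)))
      (Ioi (0 : ℝ)) volume := by
    rw [locallyIntegrableOn_iff isOpen_Ioi.isLocallyClosed]
    intro K hK hKc
    obtain ⟨N, hN⟩ := hKc.isBounded.subset_closedBall 0
    have h1 := (integrable_prod_polarPoint ((hP.integrableOn_isCompact (isCompact_closedBall 0 N)
      ).integrable_indicator measurableSet_closedBall)).integral_prod_left
    have h2 : IntegrableOn _ K volume := (show IntegrableOn _ (Ioi (0 : ℝ)) volume from h1).mono_set hK
    refine (integrableOn_congr_fun (fun r hr => ?_) hKc.isClosed.measurableSet).1 h2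
    have hr0 : (0 : ℝ) < r := hK hr
    have hrN : r ≤ N := by
      have := hN hr
      rw [mem_closedBall_zero_iff, norm_eq_abs, abs_of_pos hr0] at this
      exact this
    simp only [← integral_const_mul]
    refine integral_congr_ae (Eventually.of_forall fun θ => ?_)
    have hmem : polarPoint (r, θ) ∈ Metric.closedBall (0 : EuclideanSpace ℝ (Fin 2)) N := by
      rw [mem_closedBall_zero_iff, norm_polarPoint hr0.le]; exact hrN
    simp only [indicator_of_mem hmem]
  -- This is the fundamental lemma of the calculus of variations in the radius on `(0, ∞)`, applied
  -- to `r` times the circle integral.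
  have hz := isOpen_Ioi.ae_eq_zero_of_integral_contDiff_smul_eq_zero hloc (fun k hk hkc hks => ?_)
  · rw [ae_restrict_iff' measurableSet_Ioi]
    filter_upwards [hz] with r hr hr0
    exact (mul_eq_zero.1 (hr hr0)).resolve_left (ne_of_gt hr0)
  · have hkc' : HasCompactSupport (fun x : EuclideanSpace ℝ (Fin 2) => k ‖x‖) := by
      obtain ⟨N, hN⟩ := hkc.isBounded.subset_closedBall 0
      refine HasCompactSupport.intro (isCompact_closedBall 0 N) fun x hx => ?_
      refine image_eq_zero_of_notMem_tsupport fun h => hx ?_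
      have := hN h
      simpa using this
    have hi : Integrable (fun x => k ‖x‖ * P x) volume :=
      integrable_continuous_mul (hk.continuous.comp continuous_norm) hkc' hP
    have := hrad k hk hkc hks
    rw [integral_eq_integral_polarPoint hi] at this
    rw [← this, ← setIntegral_eq_integral_of_forall_compl_eq_zero (s := Ioi (0 : ℝ))]
    · refine setIntegral_congr_fun measurableSet_Ioi fun r hr => ?_
      simp only [norm_polarPoint (le_of_lt hr), integral_const_mul, smul_eq_mul]
      ring
    · intro r hr
      rw [image_eq_zero_of_notMem_tsupport (fun h => hr (hks h)), zero_smul]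

theorem hasDerivAt_comp_polarPoint {φ : EuclideanSpace ℝ (Fin 2) → ℝ} (hφ : ContDiff ℝ ∞ φ)
    (r θ : ℝ) :
    HasDerivAt (fun θ => φ (polarPoint (r, θ)))
      (gradient φ (polarPoint (r, θ)) 1 * polarPoint (r, θ) 0 -
        gradient φ (polarPoint (r, θ)) 0 * polarPoint (r, θ) 1) θ := by
  have hp : (fun θ => polarPoint (r, θ)) = fun θ =>
      (r * cos θ) • EuclideanSpace.single (0 : Fin 2) (1 : ℝ) +
        (r * sin θ) • EuclideanSpace.single (1 : Fin 2) (1 : ℝ) := by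
    ext θ i
    fin_cases i <;> simp
  have h1 : HasDerivAt (fun θ => polarPoint (r, θ))
      ((r * -sin θ) • EuclideanSpace.single (0 : Fin 2) (1 : ℝ) +
        (r * cos θ) • EuclideanSpace.single (1 : Fin 2) (1 : ℝ)) θ := by
    rw [hp]
    exact (((hasDerivAt_cos θ).const_mul r).smul_const _).add
      (((hasDerivAt_sin θ).const_mul r).smul_const _)
  have h2 := ((hφ.differentiable (by simp)) (polarPoint (r, θ))).hasFDerivAt.comp_hasDerivAt θ h1
  rw [map_add, map_smul, map_smul, ← gradient_apply, ← gradient_apply] at h2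
  refine h2.congr_deriv ?_
  simp
  ring

theorem continuous_polarPoint : Continuous polarPoint := by
  unfold polarPoint
  fun_prop

/-- Wirtinger's inequality on all circles at once. -/
theorem integral_radial_mul_le {w : ℝ → ℝ} {φ P : EuclideanSpace ℝ (Fin 2) → ℝ} {κ : ℝ}
    (hκ : 0 < κ) (hw : Continuous (fun x : EuclideanSpace ℝ (Fin 2) => w ‖x‖))
    (hwc : HasCompactSupport (fun x : EuclideanSpace ℝ (Fin 2) => w ‖x‖)) (hw0 : ∀ r, 0 ≤ w r)
    (hφ : ContDiff ℝ ∞ φ) (hP : MemL2loc P)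
    (hmean : ∀ᵐ r ∂volume.restrict (Ioi (0 : ℝ)),
      ∫ θ in Ioo (-π) π, P (polarPoint (r, θ)) = 0) :
    ∫ x, w ‖x‖ * (φ x * P x) ≤ ∫ x, w ‖x‖ *
      (κ / 2 * (gradient φ x 1 * x 0 - gradient φ x 0 * x 1) ^ 2 + 1 / (2 * κ) * P x ^ 2) := by
  have hP2 : LocallyIntegrable (fun x => P x ^ 2) volume := by
    simpa only [sq] using hP.locallyIntegrable_mul hP
  have hQc : Continuous fun x : EuclideanSpace ℝ (Fin 2) =>
      gradient φ x 1 * x 0 - gradient φ x 0 * x 1 := by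
    have hx : ∀ i : Fin 2, Continuous fun x : EuclideanSpace ℝ (Fin 2) => x i :=
      fun i => (EuclideanSpace.proj (𝕜 := ℝ) i).continuous
    exact ((continuous_gradient_apply hφ 1).mul (hx 0)).sub
      ((continuous_gradient_apply hφ 0).mul (hx 1))
  have hI1 : Integrable (fun x => w ‖x‖ * (φ x * P x)) volume :=
    integrable_continuous_mul hw hwc (hP.continuous_mul hφ.continuous).locallyIntegrable
  have hI2 : Integrable (fun x => w ‖x‖ *
      (κ / 2 * (gradient φ x 1 * x 0 - gradient φ x 0 * x 1) ^ 2 + 1 / (2 * κ) * P x ^ 2))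
      volume := by
    have hc : Continuous fun x : EuclideanSpace ℝ (Fin 2) =>
        κ / 2 * (gradient φ x 1 * x 0 - gradient φ x 0 * x 1) ^ 2 := (hQc.pow 2).const_mul _
    have ha : Integrable (fun x => w ‖x‖ *
        (κ / 2 * (gradient φ x 1 * x 0 - gradient φ x 0 * x 1) ^ 2)) volume :=
      integrable_continuous_mul hw hwc hc.locallyIntegrable
    have hb := (integrable_continuous_mul hw hwc hP2).const_mul (1 / (2 * κ))
    refine (ha.add hb).congr (Eventually.of_forall fun x => ?_)
    simp only [Pi.add_apply]
    ring
  rw [integral_eq_integral_polarPoint hI1, integral_eq_integral_polarPoint hI2]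
  have hL : ∀ {f : EuclideanSpace ℝ (Fin 2) → ℝ}, Integrable f volume →
      IntegrableOn (fun r => r * ∫ θ in Ioo (-π) π, f (polarPoint (r, θ))) (Ioi (0 : ℝ)) := by
    intro f hf
    simpa only [integral_const_mul, IntegrableOn] using
      (integrable_prod_polarPoint hf).integral_prod_left
  -- The weight depends only on the radius, so it factors out of each circle integral.
  refine integral_mono_ae (hL hI1) (hL hI2) ?_
  filter_upwards [hmean, ae_integrableOn_polarPoint hP.locallyIntegrable,
    ae_integrableOn_polarPoint hP2, ae_restrict_mem measurableSet_Ioi] with r h1 h2 h3 hr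
  have hr0 : (0 : ℝ) < r := hr
  simp only [norm_polarPoint hr0.le, integral_const_mul]
  refine mul_le_mul_of_nonneg_left (mul_le_mul_of_nonneg_left ?_ (hw0 r)) hr0.le
  refine integral_mul_le_of_integral_eq_zero (fun θ => hasDerivAt_comp_polarPoint hφ r θ) ?_ ?_
    ((memLp_two_iff_integrable_sq h2.1).2 h3) h1 hκ
  · exact hQc.comp (continuous_polarPoint.comp (by fun_prop))
  · have : polarPoint (r, -π) = polarPoint (r, π) := by
      ext i; fin_cases i <;> simp
    rw [this]

end PolarCoordinates

/-! ### Convergence in `L²_loc`. -/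

section LocalConvergence

open Filter Topology Set
open scoped ENNReal

variable {n : ℕ}

/-- Convergence in `L²_loc`. -/
def TendstoL2loc (fk : ℕ → EuclideanSpace ℝ (Fin n) → ℝ) (f : EuclideanSpace ℝ (Fin n) → ℝ) :
    Prop :=
  ∀ K : Set (EuclideanSpace ℝ (Fin n)), IsCompact K →
    Tendsto (fun k => eLpNorm (fun x => fk k x - f x) 2 (volume.restrict K)) atTop (𝓝 0)

theorem TendstoL2loc.add {fk gk : ℕ → EuclideanSpace ℝ (Fin n) → ℝ}
    {f g : EuclideanSpace ℝ (Fin n) → ℝ} (hf : TendstoL2loc fk f) (hg : TendstoL2loc gk g)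
    (mf : MemL2loc f) (mg : MemL2loc g) (mfk : ∀ k, MemL2loc (fk k)) (mgk : ∀ k, MemL2loc (gk k)) :
    TendstoL2loc (fun k x => fk k x + gk k x) (fun x => f x + g x) := by
  intro K hK
  have hs := (hf K hK).add (hg K hK)
  rw [add_zero] at hs
  refine tendsto_of_tendsto_of_tendsto_of_le_of_le tendsto_const_nhds hs (fun _ => zero_le)
    fun k => ?_
  have := eLpNorm_add_le (((mfk k) K hK).1.sub (mf K hK).1) (((mgk k) K hK).1.sub (mg K hK).1)
    (p := 2) (by norm_num)
  refine le_trans (le_of_eq ?_) this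
  congr 1
  ext x
  simp only [Pi.add_apply, Pi.sub_apply]
  ring

theorem TendstoL2loc.continuous_mul {fk : ℕ → EuclideanSpace ℝ (Fin n) → ℝ}
    {f c : EuclideanSpace ℝ (Fin n) → ℝ} (hf : TendstoL2loc fk f) (hc : Continuous c) :
    TendstoL2loc (fun k x => c x * fk k x) (fun x => c x * f x) := by
  intro K hK
  obtain ⟨C, hC⟩ := hK.exists_bound_of_continuousOn hc.continuousOn
  have hs := ENNReal.Tendsto.const_mul (a := ENNReal.ofReal C) (hf K hK)
    (Or.inr ENNReal.ofReal_ne_top)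
  rw [mul_zero] at hs
  refine tendsto_of_tendsto_of_tendsto_of_le_of_le tendsto_const_nhds hs (fun _ => zero_le)
    fun k => ?_
  refine eLpNorm_le_mul_eLpNorm_of_ae_le_mul ?_ 2
  filter_upwards [ae_restrict_mem hK.isClosed.measurableSet] with x hx
  rw [← mul_sub, norm_mul]
  exact mul_le_mul_of_nonneg_right (hC x hx) (norm_nonneg _)

theorem TendstoL2loc.tendsto_integral {fk gk : ℕ → EuclideanSpace ℝ (Fin n) → ℝ}
    {f g ψ : EuclideanSpace ℝ (Fin n) → ℝ} (hf : TendstoL2loc fk f) (hg : TendstoL2loc gk g)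
    (mf : MemL2loc f) (mg : MemL2loc g) (mfk : ∀ k, MemL2loc (fk k)) (mgk : ∀ k, MemL2loc (gk k))
    (hψ : Continuous ψ) (hc : HasCompactSupport ψ) :
    Tendsto (fun k => ∫ x, ψ x * (fk k x * gk k x)) atTop (𝓝 (∫ x, ψ x * (f x * g x))) := by
  have h := tendsto_integral_mul_of_tendsto_eLpNorm
    (mf.continuous_mul hψ (tsupport ψ) hc) (mg _ hc)
    (fun k => (mfk k).continuous_mul hψ (tsupport ψ) hc) (fun k => mgk k _ hc)
    (hf.continuous_mul hψ _ hc) (hg _ hc)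
  have key : ∀ a b : EuclideanSpace ℝ (Fin n) → ℝ,
      ∫ x in tsupport ψ, ψ x * a x * b x = ∫ x, ψ x * (a x * b x) := by
    intro a b
    simp only [mul_assoc]
    exact setIntegral_eq_integral_of_forall_compl_eq_zero fun x hx => by
      simp [image_eq_zero_of_notMem_tsupport hx]
  simpa only [key] using h

theorem tendstoL2loc_mollify {f : EuclideanSpace ℝ (Fin n) → ℝ} (hf : MemL2loc f) :
    TendstoL2loc (mollify f) f :=
  fun _ hK => tendsto_mollify_eLpNorm hf hK

theorem tendstoL2loc_const (f : EuclideanSpace ℝ (Fin n) → ℝ) : TendstoL2loc (fun _ => f) f := by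
  intro K _
  simp

end LocalConvergence

/-! ### Bounds on the coefficients and flux through circles. -/

section Flux

open Filter Topology Set

variable {n : ℕ}

/-- Polarization: the quadratic form at `eᵢ + eⱼ` minus that at `eᵢ - eⱼ` is `4 Aᵢⱼ`, and both
values lie in `[0, 4L]`. The crude bound `4` for the squared norms also covers `i = j`. -/
theorem EllipticClass.abs_apply_le {lam L : ℝ} (hlam : 0 ≤ lam)
    {A : EuclideanSpace ℝ (Fin n) → Matrix (Fin n) (Fin n) ℝ} (hA : A ∈ EllipticClass n lam L)
    (x : EuclideanSpace ℝ (Fin n)) (i j : Fin n) : |A x i j| ≤ L := by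
  obtain ⟨-, hs, he⟩ := hA
  have hsym : A x j i = A x i j := by
    have := congrFun (congrFun (hs x) i) j
    simpa using this
  have hn : ∀ s : ℝ, s ^ 2 = 1 → ‖EuclideanSpace.single i (1 : ℝ) +
      s • EuclideanSpace.single j (1 : ℝ)‖ ^ 2 ≤ 4 := by
    intro s hs
    have hs1 : |s| = 1 := (abs_eq zero_le_one).2 (by simpa using hs)
    have := norm_add_le (EuclideanSpace.single i (1 : ℝ)) (s • EuclideanSpace.single j (1 : ℝ))
    rw [norm_smul, Real.norm_eq_abs, hs1] at this
    simp only [PiLp.norm_single, norm_one, mul_one] at this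
    nlinarith [norm_nonneg (EuclideanSpace.single i (1 : ℝ) +
      s • EuclideanSpace.single j (1 : ℝ))]
  have hQ : ∀ s : ℝ, (A x *ᵥ (EuclideanSpace.single i (1 : ℝ) +
      s • EuclideanSpace.single j (1 : ℝ)).ofLp) ⬝ᵥ (EuclideanSpace.single i (1 : ℝ) +
      s • EuclideanSpace.single j (1 : ℝ)).ofLp = A x i i + 2 * s * A x i j + s ^ 2 * A x j j := by
    intro s
    simp only [WithLp.ofLp_add, WithLp.ofLp_smul, PiLp.ofLp_single, Matrix.mulVec_add,
      Matrix.mulVec_smul, Matrix.mulVec_single_one, dotProduct_add, dotProduct_smul,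
      dotProduct_single_one, Pi.add_apply, Pi.smul_apply, Matrix.col_apply, smul_eq_mul, hsym]
    ring
  have hL : 0 ≤ L := by
    have h := he x (EuclideanSpace.single i 1)
    simp only [PiLp.norm_single, norm_one] at h
    linarith [h.1.trans h.2]
  have h1 := he x (EuclideanSpace.single i (1 : ℝ) + (1 : ℝ) • EuclideanSpace.single j (1 : ℝ))
  have h2 := he x (EuclideanSpace.single i (1 : ℝ) + (-1 : ℝ) • EuclideanSpace.single j (1 : ℝ))
  rw [hQ] at h1 h2
  have n1 := mul_le_mul_of_nonneg_left (hn 1 (by norm_num)) hL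
  have n2 := mul_le_mul_of_nonneg_left (hn (-1) (by norm_num)) hL
  have p1 := mul_nonneg hlam (sq_nonneg ‖EuclideanSpace.single i (1 : ℝ) +
    (1 : ℝ) • EuclideanSpace.single j (1 : ℝ)‖)
  have p2 := mul_nonneg hlam (sq_nonneg ‖EuclideanSpace.single i (1 : ℝ) +
    (-1 : ℝ) • EuclideanSpace.single j (1 : ℝ)‖)
  rw [abs_le]
  constructor <;> linarith [h1.1, h1.2, h2.1, h2.2]

theorem EllipticClass.memL2loc_flux {lam L : ℝ} (hlam : 0 ≤ lam)
    {A : EuclideanSpace ℝ (Fin n) → Matrix (Fin n) (Fin n) ℝ} (hA : A ∈ EllipticClass n lam L)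
    {V : EuclideanSpace ℝ (Fin n) → EuclideanSpace ℝ (Fin n)} (hV : MemL2loc V) (i : Fin n) :
    MemL2loc (fun x => (A x *ᵥ (V x).ofLp) i) := by
  simp only [Matrix.mulVec, dotProduct]
  exact MemL2loc.sum _ fun j _ => (hV.coord j).bdd_mul (hA.1 i j).aestronglyMeasurable
    fun K _ => ⟨L, fun x _ => EllipticClass.abs_apply_le hlam hA x i j⟩

theorem gradient_comp_norm_sq_apply {H : ℝ → ℝ} {H' : ℝ} {x : EuclideanSpace ℝ (Fin n)}
    (h : HasDerivAt H H' (‖x‖ ^ 2)) (i : Fin n) :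
    gradient (fun y : EuclideanSpace ℝ (Fin n) => H (‖y‖ ^ 2)) x i = 2 * H' * x i := by
  have h1 := h.comp_hasFDerivAt x (hasStrictFDerivAt_norm_sq x).hasFDerivAt
  rw [gradient_apply, HasFDerivAt.fderiv (f := fun y => H (‖y‖ ^ 2)) h1]
  simp [EuclideanSpace.inner_single_right]
  ring

/-- A weakly divergence free field has vanishing flux through circles, in integrated form. -/
theorem integral_radial_mul_flux_eq_zero {F : EuclideanSpace ℝ (Fin n) → Fin n → ℝ}
    (hdiv : ∀ φ : EuclideanSpace ℝ (Fin n) → ℝ, IsTestFunction φ →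
      ∫ x, F x ⬝ᵥ (gradient φ x).ofLp = 0)
    {k : ℝ → ℝ} (hk : ContDiff ℝ ∞ k) (hkc : HasCompactSupport k) (hks : tsupport k ⊆ Ioi 0) :
    ∫ x, k ‖x‖ * (F x ⬝ᵥ x.ofLp) = 0 := by
  -- Writing the radial weight as a function of `‖x‖²` avoids the singularity of the norm at the
  -- origin. It is smooth because `k` vanishes near `0`.
  set m : ℝ → ℝ := fun s => k (√s) with hm
  have hms : ContDiff ℝ ∞ m := by
    rw [contDiff_iff_contDiffAt]
    intro s
    rcases lt_or_ge 0 s with hs | hs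
    · exact hk.contDiffAt.comp s (Real.contDiffAt_sqrt hs.ne')
    · have h0 : √s ∉ tsupport k := fun h => by
        have : 0 < √s := hks h
        rw [Real.sqrt_eq_zero_of_nonpos hs] at this
        exact lt_irrefl _ this
      have hev : m =ᶠ[𝓝 s] fun _ => 0 := by
        have := (Real.continuous_sqrt.tendsto s).eventually
          ((isClosed_tsupport k).isOpen_compl.mem_nhds h0)
        filter_upwards [this] with t ht
        exact image_eq_zero_of_notMem_tsupport (f := k) ht
      exact contDiffAt_const.congr_of_eventuallyEq hev
  obtain ⟨R, hR0, hR⟩ := hkc.isBounded.exists_pos_norm_lt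
  have hm0 : ∀ s, R ^ 2 ≤ s → m s = 0 := by
    intro s hs
    refine image_eq_zero_of_notMem_tsupport (f := k) fun h => ?_
    have h1 := hR _ h
    rw [Real.norm_eq_abs, abs_of_nonneg (Real.sqrt_nonneg s)] at h1
    have : R ≤ √s := Real.le_sqrt_of_sq_le hs
    linarith
  -- The primitive based at `R²` vanishes beyond `R²`, so `G (‖x‖²)` has compact support, and its
  -- gradient is `2 k(‖x‖) x`.
  set G : ℝ → ℝ := fun s => ∫ t in (R ^ 2)..s, m t with hG
  have hGd : ∀ s, HasDerivAt G (m s) s := fun s =>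
    intervalIntegral.integral_hasDerivAt_right (hms.continuous.intervalIntegrable _ _)
      (hms.continuous.stronglyMeasurableAtFilter _ _) hms.continuous.continuousAt
  have hGs : ContDiff ℝ ∞ G := by
    rw [contDiff_infty_iff_deriv]
    refine ⟨fun s => (hGd s).differentiableAt, ?_⟩
    rw [show deriv G = m from funext fun s => (hGd s).deriv]
    exact hms
  have hφ : IsTestFunction (fun x : EuclideanSpace ℝ (Fin n) => G (‖x‖ ^ 2)) := by
    refine ⟨hGs.comp (contDiff_norm_sq ℝ), HasCompactSupport.intro
      (isCompact_closedBall (0 : EuclideanSpace ℝ (Fin n)) R) fun x hx => ?_⟩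
    have hx' : R < ‖x‖ := by simpa using hx
    have hx2 : R ^ 2 ≤ ‖x‖ ^ 2 := by gcongr
    simp only [hG]
    rw [intervalIntegral.integral_congr (g := fun _ => 0)]
    · simp
    · intro t ht
      rw [uIcc_of_le hx2] at ht
      exact hm0 t ht.1
  have h := hdiv _ hφ
  have hgr : ∀ x : EuclideanSpace ℝ (Fin n), F x ⬝ᵥ
      (gradient (fun x : EuclideanSpace ℝ (Fin n) => G (‖x‖ ^ 2)) x).ofLp =
      2 * (k ‖x‖ * (F x ⬝ᵥ x.ofLp)) := by
    intro x
    have hm' : m (‖x‖ ^ 2) = k ‖x‖ := by simp [hm, Real.sqrt_sq (norm_nonneg x)]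
    have : (gradient (fun x : EuclideanSpace ℝ (Fin n) => G (‖x‖ ^ 2)) x).ofLp =
        (2 * k ‖x‖) • x.ofLp := by
      ext i
      rw [gradient_comp_norm_sq_apply (hGd _), hm']
      rfl
    rw [this, dotProduct_smul, smul_eq_mul, mul_assoc]
  simp_rw [hgr, integral_const_mul] at h
  linarith

end Flux

/-! ### The weighted energy inequality. -/

section Monotonicity

open Filter Topology Set

/-- Radial and angular components are controlled by the energy density. -/
theorem flux_sq_add_angular_sq_le {lam L : ℝ} (hlam : 0 < lam) (hL : 0 < L)
    {M : Matrix (Fin 2) (Fin 2) ℝ} (hs : M.IsSymm)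
    (he : ∀ ξ : EuclideanSpace ℝ (Fin 2), lam * ‖ξ‖ ^ 2 ≤ (M *ᵥ ξ.ofLp) ⬝ᵥ ξ.ofLp ∧
      (M *ᵥ ξ.ofLp) ⬝ᵥ ξ.ofLp ≤ L * ‖ξ‖ ^ 2) (v x : EuclideanSpace ℝ (Fin 2)) :
    lam * (v 1 * x 0 - v 0 * x 1) ^ 2 + 1 / L * ((M *ᵥ v.ofLp) ⬝ᵥ x.ofLp) ^ 2 ≤
      ‖x‖ ^ 2 * ((M *ᵥ v.ofLp) ⬝ᵥ v.ofLp) := by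
  have hsym : M 1 0 = M 0 1 := by
    have := congrFun (congrFun hs 0) 1
    simpa using this
  have hq := he x
  set P := (M *ᵥ v.ofLp) ⬝ᵥ x.ofLp with hP
  set q := (M *ᵥ x.ofLp) ⬝ᵥ x.ofLp with hqd
  set e := (M *ᵥ v.ofLp) ⬝ᵥ v.ofLp with hed
  rcases eq_or_ne x 0 with rfl | hx
  · simp [hP]
  have hx2 : 0 < ‖x‖ ^ 2 := by positivity
  have hq0 : 0 < q := lt_of_lt_of_le (by positivity) hq.1
  -- The vector `q v - P x` is orthogonal to `x` for the form `M`: it is `q` times the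
  -- `M`-projection of `v` off `x`. Hence its energy is `q (q e - P²)`.
  have hξ := (he (q • v - P • x)).1
  have h1 : (M *ᵥ (q • v - P • x).ofLp) ⬝ᵥ (q • v - P • x).ofLp = q * (q * e - P ^ 2) := by
    have hPs : (M *ᵥ x.ofLp) ⬝ᵥ v.ofLp = P := by
      simp only [hP, Matrix.mulVec, dotProduct, Fin.sum_univ_two, hsym]
      ring
    simp only [WithLp.ofLp_sub, WithLp.ofLp_smul, Matrix.mulVec_sub, Matrix.mulVec_smul,
      dotProduct_sub, dotProduct_smul, sub_dotProduct, smul_dotProduct, hPs, ← hP, ← hqd, ← hed,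
      smul_eq_mul]
    ring
  rw [h1] at hξ
  set Q := v 1 * x 0 - v 0 * x 1 with hQ
  -- Subtracting a multiple of `x` does not change the cross product with `x`, so that of `q v - P
  -- x` is `q Q`; Lagrange's identity bounds it.
  have h2 : q ^ 2 * Q ^ 2 ≤ ‖q • v - P • x‖ ^ 2 * ‖x‖ ^ 2 := by
    rw [norm_sq_eq, norm_sq_eq]
    have e0 : (q • v - P • x) 0 = q * v 0 - P * x 0 := rfl
    have e1 : (q • v - P • x) 1 = q * v 1 - P * x 1 := rfl
    rw [e0, e1]
    have : ((q * v 0 - P * x 0) ^ 2 + (q * v 1 - P * x 1) ^ 2) * (x 0 ^ 2 + x 1 ^ 2) -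
        q ^ 2 * Q ^ 2 = ((q * v 0 - P * x 0) * x 0 + (q * v 1 - P * x 1) * x 1) ^ 2 := by
      rw [hQ]; ring
    nlinarith [sq_nonneg ((q * v 0 - P * x 0) * x 0 + (q * v 1 - P * x 1) * x 1)]
  have h3 : lam * q * Q ^ 2 ≤ (q * e - P ^ 2) * ‖x‖ ^ 2 := by
    have h4 : lam * (q ^ 2 * Q ^ 2) ≤ q * (q * e - P ^ 2) * ‖x‖ ^ 2 :=
      calc _ ≤ lam * (‖q • v - P • x‖ ^ 2 * ‖x‖ ^ 2) := by gcongr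
        _ = (lam * ‖q • v - P • x‖ ^ 2) * ‖x‖ ^ 2 := by ring
        _ ≤ _ := by gcongr
    refine le_of_mul_le_mul_left ?_ hq0
    linarith
  have h5 : 1 / L * P ^ 2 * q ≤ P ^ 2 * ‖x‖ ^ 2 := by
    rw [one_div, mul_assoc, inv_mul_le_iff₀ hL]
    nlinarith [mul_le_mul_of_nonneg_left hq.2 (sq_nonneg P)]
  refine le_of_mul_le_mul_right ?_ hq0
  linarith

/-- The weighted energy inequality underlying the monotonicity of
`r ^ (-2 * √(lam / L)) ∫_{B_r} A ∇u · ∇u`. -/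
theorem integral_test_mul_energy_le {lam L : ℝ} (hlam : 0 < lam) (hL : 0 < L)
    {A : EuclideanSpace ℝ (Fin 2) → Matrix (Fin 2) (Fin 2) ℝ} (hA : A ∈ EllipticClass 2 lam L)
    {u : EuclideanSpace ℝ (Fin 2) → ℝ} {V : EuclideanSpace ℝ (Fin 2) → EuclideanSpace ℝ (Fin 2)}
    (h : IsH1locWithGradient u V)
    (hdiv : ∀ φ : EuclideanSpace ℝ (Fin 2) → ℝ, IsTestFunction φ →
      ∫ x, (A x *ᵥ (V x).ofLp) ⬝ᵥ (gradient φ x).ofLp = 0)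
    {η : EuclideanSpace ℝ (Fin 2) → ℝ} (hη : IsTestFunction η) {w : ℝ → ℝ}
    (hw : Continuous (fun x : EuclideanSpace ℝ (Fin 2) => w ‖x‖))
    (hwc : HasCompactSupport (fun x : EuclideanSpace ℝ (Fin 2) => w ‖x‖)) (hw0 : ∀ r, 0 ≤ w r)
    (hηw : ∀ x i, gradient η x i = -(w ‖x‖) * x i) :
    ∫ x, η x * ((A x *ᵥ (V x).ofLp) ⬝ᵥ (V x).ofLp) ≤
      L / (2 * √(lam * L)) * ∫ x, w ‖x‖ * (‖x‖ ^ 2 * ((A x *ᵥ (V x).ofLp) ⬝ᵥ (V x).ofLp)) := by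
  set F : EuclideanSpace ℝ (Fin 2) → Fin 2 → ℝ := fun x => A x *ᵥ (V x).ofLp with hFd
  have hF : ∀ i, MemL2loc (fun x => F x i) :=
    fun i => EllipticClass.memL2loc_flux hlam.le hA h.2.1 i
  have hx : ∀ i : Fin 2, Continuous fun x : EuclideanSpace ℝ (Fin 2) => x i :=
    fun i => (EuclideanSpace.proj (𝕜 := ℝ) i).continuous
  set P : EuclideanSpace ℝ (Fin 2) → ℝ := fun x => F x ⬝ᵥ x.ofLp with hPd
  set Q : EuclideanSpace ℝ (Fin 2) → ℝ := fun x => V x 1 * x 0 - V x 0 * x 1 with hQd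
  -- This value makes the Young weights `κ/2` and `1/(2κ)` proportional to `lam` and `1/L`, the
  -- weights in the pointwise bound.
  set κ := √(lam * L) with hκd
  have hκ : 0 < κ := Real.sqrt_pos.2 (by positivity)
  have hκ2 : κ ^ 2 = lam * L := Real.sq_sqrt (by positivity)
  have hPm : MemL2loc P := by
    have := MemL2loc.sum Finset.univ fun i (_ : i ∈ Finset.univ) => (hF i).continuous_mul (hx i)
    simpa only [hPd, dotProduct, mul_comm] using this
  have hang : ∀ W : EuclideanSpace ℝ (Fin 2) → EuclideanSpace ℝ (Fin 2),
      (fun x => W x 1 * x 0 - W x 0 * x 1) = fun x => x 0 * W x 1 + (-(x 1)) * W x 0 := by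
    intro W; ext x; ring
  have hangm : ∀ W : EuclideanSpace ℝ (Fin 2) → EuclideanSpace ℝ (Fin 2),
      (∀ i, MemL2loc fun x => W x i) → MemL2loc (fun x => W x 1 * x 0 - W x 0 * x 1) := by
    intro W hW
    rw [hang]
    exact ((hW 1).continuous_mul (hx 0)).add ((hW 0).continuous_mul (hx 1).neg)
  have hQm : MemL2loc Q := hangm V h.2.1.coord
  have hmean := ae_integral_polarPoint_eq_zero hPm.locallyIntegrable
    fun k hk hkc hks => integral_radial_mul_flux_eq_zero hdiv hk hkc hks
  have hum : ∀ k, ContDiff ℝ ∞ (mollify u k) := contDiff_mollify h.1.locallyIntegrable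
  have hgm : ∀ k i, MemL2loc (fun x => gradient (mollify u k) x i) :=
    fun k i => memL2loc_of_continuous (continuous_gradient_apply (hum k) i)
  have hgt : ∀ i, TendstoL2loc (fun k x => gradient (mollify u k) x i) (fun x => V x i) := by
    intro i
    simp_rw [gradient_mollify h]
    exact tendstoL2loc_mollify (h.2.1.coord i)
  set Qk : ℕ → EuclideanSpace ℝ (Fin 2) → ℝ := fun k x =>
    gradient (mollify u k) x 1 * x 0 - gradient (mollify u k) x 0 * x 1 with hQk
  have hQkm : ∀ k, MemL2loc (Qk k) := fun k => hangm _ (hgm k)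
  have hQt : TendstoL2loc Qk Q := by
    have := ((hgt 1).continuous_mul (hx 0)).add ((hgt 0).continuous_mul (hx 1).neg)
      ((h.2.1.coord 1).continuous_mul (hx 0)) ((h.2.1.coord 0).continuous_mul (hx 1).neg)
      (fun k => (hgm k 1).continuous_mul (hx 0)) (fun k => (hgm k 0).continuous_mul (hx 1).neg)
    rw [hQd, hang V]
    have hk : Qk = fun k x => x 0 * gradient (mollify u k) x 1 +
        (-(x 1)) * gradient (mollify u k) x 0 := funext fun k => hang _
    rw [hk]
    exact this
  -- The circle inequality requires a smooth function, so it is applied to the mollifications of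
  -- `u`, while the flux `P` of the original solution, which has mean zero on circles, is kept.
  have hlim1 : Tendsto (fun k => ∫ x, w ‖x‖ * (mollify u k x * P x)) atTop
      (𝓝 (∫ x, w ‖x‖ * (u x * P x))) :=
    (tendstoL2loc_mollify h.1).tendsto_integral (tendstoL2loc_const P) h.1 hPm
      (fun k => memL2loc_of_continuous (hum k).continuous) (fun _ => hPm) hw hwc
  have hlim2 : Tendsto (fun k => ∫ x, w ‖x‖ * (Qk k x * Qk k x)) atTop
      (𝓝 (∫ x, w ‖x‖ * (Q x * Q x))) :=
    hQt.tendsto_integral hQt hQm hQm hQkm hQkm hw hwc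
  have hi : ∀ {f : EuclideanSpace ℝ (Fin 2) → ℝ}, MemL2loc f →
      Integrable (fun x => w ‖x‖ * (f x * f x)) volume := fun hf =>
    integrable_continuous_mul hw hwc (hf.locallyIntegrable_mul hf)
  have hsplit : ∀ {f : EuclideanSpace ℝ (Fin 2) → ℝ}, MemL2loc f →
      ∫ x, w ‖x‖ * (κ / 2 * f x ^ 2 + 1 / (2 * κ) * P x ^ 2) =
      κ / 2 * (∫ x, w ‖x‖ * (f x * f x)) + 1 / (2 * κ) * ∫ x, w ‖x‖ * (P x * P x) := by
    intro f hf
    rw [← integral_const_mul, ← integral_const_mul, ← integral_add ((hi hf).const_mul _)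
      ((hi hPm).const_mul _)]
    congr 1; ext x; ring
  have hmain : ∫ x, w ‖x‖ * (u x * P x) ≤
      ∫ x, w ‖x‖ * (κ / 2 * Q x ^ 2 + 1 / (2 * κ) * P x ^ 2) := by
    rw [hsplit hQm]
    refine le_of_tendsto_of_tendsto hlim1 ((hlim2.const_mul _).add tendsto_const_nhds)
      (Eventually.of_forall fun k => ?_)
    have := integral_radial_mul_le hκ hw hwc hw0 (hum k) hPm hmean
    rwa [hsplit (hQkm k)] at this
  have htest := integral_flux_mul_test_eq_zero h hF hdiv hη
  have hgrad : ∀ x, u x * (F x ⬝ᵥ (gradient η x).ofLp) = -(w ‖x‖ * (u x * P x)) := by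
    intro x
    have : (gradient η x).ofLp = (-(w ‖x‖)) • x.ofLp := by
      ext i
      exact hηw x i
    rw [this, dotProduct_smul, smul_eq_mul]
    ring
  simp_rw [hgrad, integral_neg] at htest
  have henergy : LocallyIntegrable (fun x => ‖x‖ ^ 2 * (F x ⬝ᵥ (V x).ofLp)) volume := by
    simp only [dotProduct, Finset.mul_sum]
    refine locallyIntegrable_finsetSum _ fun i _ => ?_
    have := ((hF i).continuous_mul (g := fun x : EuclideanSpace ℝ (Fin 2) => ‖x‖ ^ 2)
      (by fun_prop)).locallyIntegrable_mul (h.2.1.coord i)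
    simpa only [mul_assoc] using this
  calc ∫ x, η x * (F x ⬝ᵥ (V x).ofLp) = ∫ x, w ‖x‖ * (u x * P x) := by linarith
    _ ≤ ∫ x, w ‖x‖ * (κ / 2 * Q x ^ 2 + 1 / (2 * κ) * P x ^ 2) := hmain
    _ ≤ ∫ x, L / (2 * κ) * (w ‖x‖ * (‖x‖ ^ 2 * (F x ⬝ᵥ (V x).ofLp))) := by
        refine integral_mono ?_ ((integrable_continuous_mul hw hwc henergy).const_mul _)
          fun x => ?_
        · refine (((hi hQm).const_mul (κ / 2)).add ((hi hPm).const_mul (1 / (2 * κ)))).congr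
            (Eventually.of_forall fun x => ?_)
          simp only [Pi.add_apply]
          ring
        · have hp := flux_sq_add_angular_sq_le hlam hL (hA.2.1 x) (hA.2.2 x) (V x) x
          have heq : κ / 2 * Q x ^ 2 + 1 / (2 * κ) * P x ^ 2 =
              L / (2 * κ) * (lam * Q x ^ 2 + 1 / L * P x ^ 2) := by
            field_simp
            rw [hκ2]
            ring
          show w ‖x‖ * (κ / 2 * Q x ^ 2 + 1 / (2 * κ) * P x ^ 2) ≤ _
          rw [heq, mul_left_comm]
          refine mul_le_mul_of_nonneg_left (mul_le_mul_of_nonneg_left hp (hw0 _)) (by positivity)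
    _ = _ := integral_const_mul _ _

end Monotonicity

/-! ### A smooth cutoff. -/

section Cutoff

open Filter Topology Set

/-- A smooth nonincreasing function equal to `1` on `(-∞, 1]` and to `0` on `[2, ∞)`. -/
noncomputable def cutoff (s : ℝ) : ℝ := Real.smoothTransition (2 - s)

theorem contDiff_cutoff : ContDiff ℝ ∞ cutoff :=
  Real.smoothTransition.contDiff.comp (contDiff_const.sub contDiff_id)

theorem cutoff_eq_one {s : ℝ} (hs : s ≤ 1) : cutoff s = 1 :=
  Real.smoothTransition.one_of_one_le (by linarith)

theorem cutoff_eq_zero {s : ℝ} (hs : 2 ≤ s) : cutoff s = 0 :=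
  Real.smoothTransition.zero_of_nonpos (by linarith)

theorem cutoff_nonneg (s : ℝ) : 0 ≤ cutoff s := Real.smoothTransition.nonneg _

theorem antitone_cutoff : Antitone cutoff := fun _ _ h =>
  Real.smoothTransition.monotone (by linarith)

theorem hasDerivAt_cutoff (s : ℝ) : HasDerivAt cutoff (deriv cutoff s) s :=
  (contDiff_cutoff.differentiable (by simp) s).hasDerivAt

theorem continuous_deriv_cutoff : Continuous (deriv cutoff) :=
  contDiff_cutoff.continuous_deriv (by simp)

theorem deriv_cutoff_nonpos (s : ℝ) : deriv cutoff s ≤ 0 := antitone_cutoff.deriv_nonpos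

theorem deriv_cutoff_eq_zero_of_lt {s : ℝ} (hs : s < 1) : deriv cutoff s = 0 := by
  have : cutoff =ᶠ[𝓝 s] fun _ => 1 := by
    filter_upwards [gt_mem_nhds hs] with t ht using cutoff_eq_one ht.le
  rw [this.deriv_eq, deriv_const]

theorem deriv_cutoff_eq_zero_of_gt {s : ℝ} (hs : 2 < s) : deriv cutoff s = 0 := by
  have : cutoff =ᶠ[𝓝 s] fun _ => 0 := by
    filter_upwards [lt_mem_nhds hs] with t ht using cutoff_eq_zero ht.le
  rw [this.deriv_eq, deriv_const]

theorem exists_abs_deriv_cutoff_le : ∃ M, 0 < M ∧ ∀ s, |deriv cutoff s| ≤ M := by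
  obtain ⟨C, hC⟩ := (isCompact_Icc (a := (1 : ℝ)) (b := 2)).exists_bound_of_continuousOn
    continuous_deriv_cutoff.continuousOn
  refine ⟨|C| + 1, by positivity, fun s => ?_⟩
  rcases lt_or_ge s 1 with h1 | h1
  · rw [deriv_cutoff_eq_zero_of_lt h1, abs_zero]; positivity
  rcases lt_or_ge 2 s with h2 | h2
  · rw [deriv_cutoff_eq_zero_of_gt h2, abs_zero]; positivity
  · have := hC s ⟨h1, h2⟩
    rw [Real.norm_eq_abs] at this
    linarith [le_abs_self C]

end Cutoff

/-! ### Caccioppoli's inequality and the Liouville property. -/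

section Growth

open Filter Topology Set

variable {n : ℕ}

theorem EllipticClass.locallyIntegrable_energy {lam L : ℝ} (hlam : 0 ≤ lam)
    {A : EuclideanSpace ℝ (Fin n) → Matrix (Fin n) (Fin n) ℝ} (hA : A ∈ EllipticClass n lam L)
    {V : EuclideanSpace ℝ (Fin n) → EuclideanSpace ℝ (Fin n)} (hV : MemL2loc V) :
    LocallyIntegrable (fun x => (A x *ᵥ (V x).ofLp) ⬝ᵥ (V x).ofLp) volume := by
  have : ∀ i, LocallyIntegrable (fun x => (A x *ᵥ (V x).ofLp) i * V x i) volume := fun i =>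
    (EllipticClass.memL2loc_flux hlam hA hV i).locallyIntegrable_mul (hV.coord i)
  simpa only [dotProduct] using locallyIntegrable_finsetSum Finset.univ fun i _ => this i

theorem EllipticClass.energy_nonneg {lam L : ℝ} (hlam : 0 ≤ lam)
    {A : EuclideanSpace ℝ (Fin n) → Matrix (Fin n) (Fin n) ℝ} (hA : A ∈ EllipticClass n lam L)
    (x ξ : EuclideanSpace ℝ (Fin n)) : 0 ≤ (A x *ᵥ ξ.ofLp) ⬝ᵥ ξ.ofLp :=
  le_trans (by positivity) (hA.2.2 x ξ).1

/-- Caccioppoli's inequality. -/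
theorem integral_sq_mul_energy_le {lam L : ℝ} (hlam : 0 < lam)
    {A : EuclideanSpace ℝ (Fin n) → Matrix (Fin n) (Fin n) ℝ} (hA : A ∈ EllipticClass n lam L)
    {u : EuclideanSpace ℝ (Fin n) → ℝ} {V : EuclideanSpace ℝ (Fin n) → EuclideanSpace ℝ (Fin n)}
    (h : IsH1locWithGradient u V)
    (hdiv : ∀ φ : EuclideanSpace ℝ (Fin n) → ℝ, IsTestFunction φ →
      ∫ x, (A x *ᵥ (V x).ofLp) ⬝ᵥ (gradient φ x).ofLp = 0)
    {ζ : EuclideanSpace ℝ (Fin n) → ℝ} (hζ : IsTestFunction ζ) :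
    ∫ x, ζ x ^ 2 * ((A x *ᵥ (V x).ofLp) ⬝ᵥ (V x).ofLp) ≤
      4 * L * ∫ x, u x ^ 2 * ‖gradient ζ x‖ ^ 2 := by
  set F : EuclideanSpace ℝ (Fin n) → Fin n → ℝ := fun x => A x *ᵥ (V x).ofLp with hFd
  have hF : ∀ i, MemL2loc (fun x => F x i) :=
    fun i => EllipticClass.memL2loc_flux hlam.le hA h.2.1 i
  have hζ2 : IsTestFunction (fun x => ζ x * ζ x) := ⟨hζ.1.mul hζ.1, hζ.2.mul_left⟩
  have htest := integral_flux_mul_test_eq_zero h hF hdiv hζ2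
  have hgr : ∀ x, (gradient (fun x => ζ x * ζ x) x).ofLp = (2 * ζ x) • (gradient ζ x).ofLp := by
    intro x
    ext i
    have hd := hζ.1.differentiable (by simp) x
    rw [gradient_mul_apply hd hd, Pi.smul_apply, smul_eq_mul]
    ring
  simp_rw [hgr, dotProduct_smul, smul_eq_mul] at htest
  have hI1 : Integrable (fun x => ζ x * ζ x * (F x ⬝ᵥ (V x).ofLp)) volume :=
    integrable_continuous_mul hζ2.1.continuous hζ2.2
      (EllipticClass.locallyIntegrable_energy hlam.le hA h.2.1)
  have hI2 : Integrable (fun x => u x * (2 * ζ x * (F x ⬝ᵥ (gradient ζ x).ofLp))) volume := by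
    simp only [dotProduct, Finset.mul_sum]
    refine integrable_finsetSum _ fun i _ => ?_
    have := integrable_continuous_mul (continuous_gradient_apply hζ.1 i)
      (hasCompactSupport_gradient_apply hζ.2 i) (h.1.locallyIntegrable_mul
        ((hF i).continuous_mul (hζ.1.continuous.const_smul (2 : ℝ))))
    refine this.congr (Eventually.of_forall fun x => ?_)
    simp only [Pi.smul_apply, smul_eq_mul]
    ring
  have hI3 : Integrable (fun x => u x ^ 2 * ‖gradient ζ x‖ ^ 2) volume := by
    simp only [EuclideanSpace.norm_sq_eq, Finset.mul_sum]
    refine integrable_finsetSum _ fun i _ => ?_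
    have := integrable_continuous_mul ((continuous_gradient_apply hζ.1 i).mul
      (continuous_gradient_apply hζ.1 i)) (hasCompactSupport_gradient_apply hζ.2 i).mul_left
      (h.1.locallyIntegrable_mul h.1)
    refine this.congr (Eventually.of_forall fun x => ?_)
    simp only [Pi.mul_apply, Real.norm_eq_abs, sq_abs]
    ring
  have hpt : ∀ x, -(u x * (2 * ζ x * (F x ⬝ᵥ (gradient ζ x).ofLp))) ≤
      1 / 2 * (ζ x * ζ x * (F x ⬝ᵥ (V x).ofLp)) + 2 * L * (u x ^ 2 * ‖gradient ζ x‖ ^ 2) := by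
    intro x
    -- Half the energy of `ζ∇u + 2u∇ζ` is the Young inequality that leaves half of `ζ² e` to be
    -- absorbed; this is where `4L` comes from.
    have h1 := EllipticClass.energy_nonneg hlam.le hA x (ζ x • V x + (2 * u x) • gradient ζ x)
    have hsym : (A x *ᵥ (gradient ζ x).ofLp) ⬝ᵥ (V x).ofLp = F x ⬝ᵥ (gradient ζ x).ofLp := by
      have hs := hA.2.1 x
      rw [Matrix.IsSymm] at hs
      rw [dotProduct_comm, Matrix.dotProduct_mulVec, ← Matrix.mulVec_transpose, hs]
    simp only [WithLp.ofLp_add, WithLp.ofLp_smul, Matrix.mulVec_add, Matrix.mulVec_smul,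
      dotProduct_add, dotProduct_smul, add_dotProduct, smul_dotProduct, hsym, smul_eq_mul] at h1
    have h2 := mul_le_mul_of_nonneg_left (hA.2.2 x (gradient ζ x)).2 (sq_nonneg (u x))
    simp only [hFd] at *
    nlinarith
  have hfin := integral_mono hI2.neg ((hI1.const_mul (1 / 2)).add (hI3.const_mul (2 * L))) hpt
  simp only [Pi.neg_apply, Pi.add_apply] at hfin
  rw [integral_neg, integral_add (hI1.const_mul (1 / 2)) (hI3.const_mul (2 * L)),
    integral_const_mul, integral_const_mul] at hfin
  simp only [sq (ζ _)]
  linarith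

theorem isTestFunction_cutoff {R : ℝ} (hR : 0 < R) :
    IsTestFunction (fun x : EuclideanSpace ℝ (Fin n) => cutoff (‖x‖ ^ 2 / R)) := by
  refine ⟨contDiff_cutoff.comp ((contDiff_norm_sq ℝ).div_const R), HasCompactSupport.intro
    (isCompact_closedBall (0 : EuclideanSpace ℝ (Fin n)) (√(2 * R))) fun x hx => ?_⟩
  have hx' : √(2 * R) < ‖x‖ := by simpa using hx
  refine cutoff_eq_zero ?_
  rw [le_div_iff₀ hR]
  exact (Real.lt_sq_of_sqrt_lt hx').le

theorem gradient_cutoff_apply (R : ℝ) (x : EuclideanSpace ℝ (Fin n)) (i : Fin n) :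
    gradient (fun x : EuclideanSpace ℝ (Fin n) => cutoff (‖x‖ ^ 2 / R)) x i =
      2 * (deriv cutoff (‖x‖ ^ 2 / R) / R) * x i := by
  refine gradient_comp_norm_sq_apply (H := fun s => cutoff (s / R)) ?_ i
  have := (hasDerivAt_cutoff (‖x‖ ^ 2 / R)).comp (‖x‖ ^ 2) ((hasDerivAt_id _).div_const R)
  simpa [Function.comp_def, div_eq_mul_inv] using this

/-- The energy of a solution of growth `γ` on balls of radius `R`. -/
theorem exists_integral_cutoff_energy_le {lam L : ℝ} (hlam : 0 < lam) (hL : 0 < L)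
    {A : EuclideanSpace ℝ (Fin 2) → Matrix (Fin 2) (Fin 2) ℝ} (hA : A ∈ EllipticClass 2 lam L)
    {u : EuclideanSpace ℝ (Fin 2) → ℝ} {V : EuclideanSpace ℝ (Fin 2) → EuclideanSpace ℝ (Fin 2)}
    (h : IsH1locWithGradient u V)
    (hdiv : ∀ φ : EuclideanSpace ℝ (Fin 2) → ℝ, IsTestFunction φ →
      ∫ x, (A x *ᵥ (V x).ofLp) ⬝ᵥ (gradient φ x).ofLp = 0)
    {γ : ℝ} (hγ : 0 < γ) (hu : HasGrowth u γ) :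
    ∃ C, 0 ≤ C ∧ ∀ R : ℝ, 1 ≤ R → ∫ x, cutoff (‖x‖ ^ 2 / (2 * R ^ 2)) ^ 2 *
      ((A x *ᵥ (V x).ofLp) ⬝ᵥ (V x).ofLp) ≤ C * R ^ (2 * γ) := by
  obtain ⟨C, hC, hu⟩ := hu
  obtain ⟨M, hM, hMd⟩ := exists_abs_deriv_cutoff_le
  set v : ℝ := volume.real (Metric.closedBall (0 : EuclideanSpace ℝ (Fin 2)) 1) with hv
  -- On the ball of radius `2R` one has `|u| ≤ 2C(2R)^γ` and the squared gradient of the cutoff is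
  -- at most `4M²/R²`; the area is `4R² v`. In the plane the powers `R²` and `R⁻²` cancel.
  refine ⟨4 * L * ((2 * C * 2 ^ γ) ^ 2 * (4 * M ^ 2) * (4 * v)), by positivity, fun R hR => ?_⟩
  have hR0 : 0 < R := by linarith
  refine (integral_sq_mul_energy_le hlam hA h hdiv (isTestFunction_cutoff
    (show 0 < 2 * R ^ 2 by positivity))).trans ?_
  rw [mul_assoc (4 * L)]
  refine mul_le_mul_of_nonneg_left ?_ (by positivity)
  set B := Metric.closedBall (0 : EuclideanSpace ℝ (Fin 2)) (2 * R) with hB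
  set K : ℝ := (2 * C * (2 * R) ^ γ) ^ 2 * (4 * M ^ 2 / R ^ 2) with hK
  have hBv : volume.real B = (2 * R) ^ 2 * v := by
    have := Measure.addHaar_real_closedBall volume (0 : EuclideanSpace ℝ (Fin 2))
      (show 0 ≤ 2 * R by positivity)
    rw [hB, this, hv, Measure.addHaar_real_closedBall_eq_addHaar_real_ball]
    simp
  have hBfin : volume B ≠ ⊤ := (isCompact_closedBall _ _).measure_lt_top.ne
  have hgrad : ∀ x : EuclideanSpace ℝ (Fin 2),
      ‖gradient (fun x : EuclideanSpace ℝ (Fin 2) => cutoff (‖x‖ ^ 2 / (2 * R ^ 2))) x‖ ^ 2 =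
        (deriv cutoff (‖x‖ ^ 2 / (2 * R ^ 2)) / R ^ 2) ^ 2 * ‖x‖ ^ 2 := by
    intro x
    rw [norm_sq_eq, gradient_cutoff_apply, gradient_cutoff_apply, norm_sq_eq x]
    field_simp
  have hle : ∀ᵐ x : EuclideanSpace ℝ (Fin 2), u x ^ 2 *
      ‖gradient (fun x : EuclideanSpace ℝ (Fin 2) => cutoff (‖x‖ ^ 2 / (2 * R ^ 2))) x‖ ^ 2 ≤
        B.indicator (fun _ => K) x := by
    filter_upwards [hu] with x hx
    rw [hgrad]
    by_cases hxB : x ∈ B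
    · rw [indicator_of_mem hxB]
      have hxn : ‖x‖ ≤ 2 * R := by simpa [hB] using hxB
      have h1 : (1 : ℝ) ≤ (2 * R) ^ γ := Real.one_le_rpow (by linarith) hγ.le
      have h2 : ‖x‖ ^ γ ≤ (2 * R) ^ γ := Real.rpow_le_rpow (norm_nonneg _) hxn hγ.le
      have h3 : |u x| ≤ 2 * C * (2 * R) ^ γ := hx.trans (by nlinarith)
      have h4 : u x ^ 2 ≤ (2 * C * (2 * R) ^ γ) ^ 2 := by
        rw [← sq_abs]; exact pow_le_pow_left₀ (abs_nonneg _) h3 2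
      have h5 : (deriv cutoff (‖x‖ ^ 2 / (2 * R ^ 2)) / R ^ 2) ^ 2 * ‖x‖ ^ 2 ≤
          4 * M ^ 2 / R ^ 2 := by
        have h6 : deriv cutoff (‖x‖ ^ 2 / (2 * R ^ 2)) ^ 2 ≤ M ^ 2 := by
          rw [← sq_abs]; exact pow_le_pow_left₀ (abs_nonneg _) (hMd _) 2
        have h7 : ‖x‖ ^ 2 ≤ (2 * R) ^ 2 := pow_le_pow_left₀ (norm_nonneg _) hxn 2
        calc _ = deriv cutoff (‖x‖ ^ 2 / (2 * R ^ 2)) ^ 2 * ‖x‖ ^ 2 / R ^ 4 := by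
              field_simp
          _ ≤ M ^ 2 * (2 * R) ^ 2 / R ^ 4 := by gcongr
          _ = _ := by field_simp; ring
      exact mul_le_mul h4 h5 (by positivity) (by positivity)
    · rw [indicator_of_notMem hxB]
      have hxn : 2 * R < ‖x‖ := by simpa [hB] using hxB
      rw [deriv_cutoff_eq_zero_of_gt]
      · simp
      · rw [lt_div_iff₀ (by positivity)]
        nlinarith
  have hint : Integrable (B.indicator (fun _ => K)) volume :=
    (integrable_indicator_iff measurableSet_closedBall).2 (integrableOn_const hBfin)
  calc _ ≤ ∫ x, B.indicator (fun _ => K) x :=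
        integral_mono_of_nonneg (Eventually.of_forall fun x => by positivity) hint hle
    _ = (2 * R) ^ 2 * v * K := by
        rw [integral_indicator measurableSet_closedBall, setIntegral_const, smul_eq_mul, hBv]
    _ = _ := by
        rw [hK, Real.mul_rpow (by norm_num) hR0.le, mul_comm 2 γ, Real.rpow_mul hR0.le,
          Real.rpow_two]
        field_simp
        ring

/-- The Liouville property below the critical exponent. -/
theorem isAEConst_of_hasGrowth {lam L : ℝ} (hlam : 0 < lam) (hL : 0 < L)
    {A : EuclideanSpace ℝ (Fin 2) → Matrix (Fin 2) (Fin 2) ℝ} (hA : A ∈ EllipticClass 2 lam L)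
    {u : EuclideanSpace ℝ (Fin 2) → ℝ} (hsol : IsWeakSolution A u) {γ : ℝ} (hγ : 0 < γ)
    (hγα : γ < √(lam / L)) (hu : HasGrowth u γ) : IsAEConst u := by
  obtain ⟨V, h, hdiv⟩ := hsol
  obtain ⟨C, hC, henergy⟩ := exists_integral_cutoff_energy_le hlam hL hA h hdiv hγ hu
  obtain ⟨M, hM, hMd⟩ := exists_abs_deriv_cutoff_le
  -- Here `a < α` permits absorption of the main term and `γ < a` makes the remainder decay.
  obtain ⟨a, hγa, haα⟩ := exists_between hγα
  set α := √(lam / L) with hα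
  have ha : 0 < a := hγ.trans hγa
  have hα0 : 0 < α := ha.trans haα
  have hLα : L / (2 * √(lam * L)) = 1 / (2 * α) := by
    have : √(lam * L) = α * L := by
      rw [hα, show lam * L = lam / L * L ^ 2 by field_simp, Real.sqrt_mul (by positivity),
        Real.sqrt_sq hL.le]
    rw [this]
    field_simp
  set e : EuclideanSpace ℝ (Fin 2) → ℝ := fun x => (A x *ᵥ (V x).ofLp) ⬝ᵥ (V x).ofLp with he
  have he0 : ∀ x, 0 ≤ e x := fun x => EllipticClass.energy_nonneg hlam.le hA x (V x)
  have hel : LocallyIntegrable e volume :=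
    EllipticClass.locallyIntegrable_energy hlam.le hA h.2.1
  have hdecay : ∀ R : ℝ, 1 ≤ R →
      (1 - a / α) * ∫ x, (1 + ‖x‖ ^ 2) ^ (-a) * cutoff (‖x‖ ^ 2 / R ^ 2) * e x ≤
        2 * M / α * C * R ^ (2 * (γ - a)) := by
    intro R hR
    have hR0 : 0 < R := by linarith
    -- The weight behaves like `|x|^(-2a)` at infinity; adding `1` keeps it smooth at the origin.
    set η : EuclideanSpace ℝ (Fin 2) → ℝ :=
      fun x => (1 + ‖x‖ ^ 2) ^ (-a) * cutoff (‖x‖ ^ 2 / R ^ 2) with hη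
    have hcut := isTestFunction_cutoff (n := 2) (show 0 < R ^ 2 by positivity)
    have hηt : IsTestFunction η := by
      refine ⟨ContDiff.mul ?_ hcut.1, hcut.2.mul_left⟩
      refine ContDiff.rpow_const_of_ne ?_ fun x => by positivity
      exact contDiff_const.add (contDiff_norm_sq ℝ)
    set w : ℝ → ℝ := fun r => 2 * (a * (1 + r ^ 2) ^ (-a - 1) * cutoff (r ^ 2 / R ^ 2) +
      (1 + r ^ 2) ^ (-a) * (-deriv cutoff (r ^ 2 / R ^ 2) / R ^ 2)) with hw
    have hwc : Continuous w := by
      have h1 : ∀ b : ℝ, Continuous fun r : ℝ => (1 + r ^ 2) ^ b := fun b =>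
        Continuous.rpow_const (by fun_prop) fun r => Or.inl (by positivity)
      have h2 : Continuous fun r : ℝ => cutoff (r ^ 2 / R ^ 2) :=
        contDiff_cutoff.continuous.comp (by fun_prop)
      have h3 : Continuous fun r : ℝ => deriv cutoff (r ^ 2 / R ^ 2) :=
        continuous_deriv_cutoff.comp (by fun_prop)
      exact continuous_const.mul (((continuous_const.mul (h1 _)).mul h2).add
        ((h1 _).mul (h3.neg.div_const _)))
    have hw0 : ∀ r, 0 ≤ w r := by
      intro r
      have h1 := cutoff_nonneg (r ^ 2 / R ^ 2)
      have h2 : 0 ≤ -deriv cutoff (r ^ 2 / R ^ 2) := by linarith [deriv_cutoff_nonpos (r ^ 2 / R ^ 2)]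
      simp only [hw]
      positivity
    have hws : HasCompactSupport (fun x : EuclideanSpace ℝ (Fin 2) => w ‖x‖) := by
      refine HasCompactSupport.intro (isCompact_closedBall 0 (2 * R)) fun x hx => ?_
      have hxn : 2 * R < ‖x‖ := by simpa using hx
      have h2 : 2 < ‖x‖ ^ 2 / R ^ 2 := by
        rw [lt_div_iff₀ (by positivity)]
        nlinarith
      simp only [hw, cutoff_eq_zero h2.le, deriv_cutoff_eq_zero_of_gt h2]
      simp
    have hgr : ∀ x i, gradient η x i = -(w ‖x‖) * x i := by
      intro x i
      have hd1 : HasDerivAt (fun s : ℝ => (1 + s) ^ (-a)) (-a * (1 + ‖x‖ ^ 2) ^ (-a - 1))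
          (‖x‖ ^ 2) := by
        have := ((hasDerivAt_id (‖x‖ ^ 2)).const_add 1).rpow_const (p := -a)
          (Or.inl (by simp only [id]; positivity))
        simpa using this
      have hd2 : HasDerivAt (fun s : ℝ => cutoff (s / R ^ 2))
          (deriv cutoff (‖x‖ ^ 2 / R ^ 2) / R ^ 2) (‖x‖ ^ 2) := by
        have := (hasDerivAt_cutoff (‖x‖ ^ 2 / R ^ 2)).comp (‖x‖ ^ 2)
          ((hasDerivAt_id _).div_const (R ^ 2))
        simpa [Function.comp_def, div_eq_mul_inv] using this
      refine (gradient_comp_norm_sq_apply (hd1.mul hd2) i).trans ?_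
      simp only [hw]
      ring
    have hmain := integral_test_mul_energy_le hlam hL hA h hdiv hηt
      (hwc.comp continuous_norm) hws hw0 hgr
    rw [hLα] at hmain
    have hη0 : ∀ x, 0 ≤ η x := fun x => mul_nonneg (by positivity) (cutoff_nonneg _)
    -- The first term comes from differentiating the power. The second is the derivative of the
    -- cutoff, supported in `R² ≤ ‖x‖² ≤ 2R²`, where the wider cutoff at scale `2R²` equals `1`; its
    -- energy is controlled by `henergy`.
    have hpt : ∀ x, w ‖x‖ * ‖x‖ ^ 2 ≤ 2 * a * η x +
        4 * M * R ^ (-2 * a) * cutoff (‖x‖ ^ 2 / (2 * R ^ 2)) ^ 2 := by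
      intro x
      have hs : (0 : ℝ) < 1 + ‖x‖ ^ 2 := by positivity
      have h1 : a * (1 + ‖x‖ ^ 2) ^ (-a - 1) * cutoff (‖x‖ ^ 2 / R ^ 2) * ‖x‖ ^ 2 ≤ a * η x := by
        rw [Real.rpow_sub hs, Real.rpow_one, hη]
        have h2 : ‖x‖ ^ 2 / (1 + ‖x‖ ^ 2) ≤ 1 := by
          rw [div_le_one hs]; linarith
        have h3 : 0 ≤ a * ((1 + ‖x‖ ^ 2) ^ (-a) * cutoff (‖x‖ ^ 2 / R ^ 2)) :=
          mul_nonneg ha.le (hη0 x)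
        calc _ = a * ((1 + ‖x‖ ^ 2) ^ (-a) * cutoff (‖x‖ ^ 2 / R ^ 2)) *
              (‖x‖ ^ 2 / (1 + ‖x‖ ^ 2)) := by field_simp
          _ ≤ _ := mul_le_of_le_one_right h3 h2
      have h4 : (1 + ‖x‖ ^ 2) ^ (-a) * (-deriv cutoff (‖x‖ ^ 2 / R ^ 2) / R ^ 2) * ‖x‖ ^ 2 ≤
          2 * M * R ^ (-2 * a) * cutoff (‖x‖ ^ 2 / (2 * R ^ 2)) ^ 2 := by
        rcases lt_or_ge (‖x‖ ^ 2 / R ^ 2) 1 with hlt | hge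
        · rw [deriv_cutoff_eq_zero_of_lt hlt]
          simp only [neg_zero, zero_div, mul_zero, zero_mul]
          positivity
        rcases lt_or_ge 2 (‖x‖ ^ 2 / R ^ 2) with hgt | hle
        · rw [deriv_cutoff_eq_zero_of_gt hgt]
          simp only [neg_zero, zero_div, mul_zero, zero_mul]
          positivity
        · have h5 : cutoff (‖x‖ ^ 2 / (2 * R ^ 2)) = 1 := by
            refine cutoff_eq_one ?_
            rw [div_le_iff₀ (by positivity)] at hle ⊢
            linarith
          have h6 : (1 + ‖x‖ ^ 2) ^ (-a) ≤ R ^ (-2 * a) := by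
            rw [show -2 * a = 2 * -a by ring, Real.rpow_mul hR0.le, Real.rpow_two]
            refine Real.rpow_le_rpow_of_nonpos (by positivity) ?_ (by linarith)
            rw [le_div_iff₀ (by positivity)] at hge
            linarith
          have h7 : -deriv cutoff (‖x‖ ^ 2 / R ^ 2) ≤ M :=
            (neg_le_abs _).trans (hMd _)
          have h8 : 0 ≤ -deriv cutoff (‖x‖ ^ 2 / R ^ 2) := by
            linarith [deriv_cutoff_nonpos (‖x‖ ^ 2 / R ^ 2)]
          rw [h5]
          calc _ = (1 + ‖x‖ ^ 2) ^ (-a) * (-deriv cutoff (‖x‖ ^ 2 / R ^ 2) *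
                (‖x‖ ^ 2 / R ^ 2)) := by ring
            _ ≤ R ^ (-2 * a) * (M * 2) := by gcongr
            _ = _ := by ring
      simp only [hw]
      linarith
    have hcut2 := isTestFunction_cutoff (n := 2) (show 0 < 2 * R ^ 2 by positivity)
    have hI1 : Integrable (fun x => η x * e x) volume :=
      integrable_continuous_mul hηt.1.continuous hηt.2 hel
    have hI2 : Integrable (fun x => cutoff (‖x‖ ^ 2 / (2 * R ^ 2)) ^ 2 * e x) volume := by
      simp only [sq (cutoff _)]
      exact integrable_continuous_mul (hcut2.1.continuous.mul hcut2.1.continuous)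
        hcut2.2.mul_left hel
    have hI3 : Integrable (fun x => w ‖x‖ * (‖x‖ ^ 2 * e x)) volume := by
      have := integrable_continuous_mul ((hwc.comp continuous_norm).mul
        (continuous_norm.pow 2)) hws.mul_right hel
      exact this.congr (Eventually.of_forall fun x => mul_assoc _ _ _)
    have hb : ∫ x, w ‖x‖ * (‖x‖ ^ 2 * e x) ≤ 2 * a * (∫ x, η x * e x) +
        4 * M * R ^ (-2 * a) * ∫ x, cutoff (‖x‖ ^ 2 / (2 * R ^ 2)) ^ 2 * e x := by
      rw [← integral_const_mul, ← integral_const_mul, ← integral_add (hI1.const_mul _)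
        (hI2.const_mul _)]
      refine integral_mono hI3 ((hI1.const_mul _).add (hI2.const_mul _)) fun x => ?_
      have := mul_le_mul_of_nonneg_right (hpt x) (he0 x)
      linarith
    have hE := mul_le_mul_of_nonneg_left (henergy R hR)
      (show 0 ≤ 4 * M * R ^ (-2 * a) by positivity)
    have hpow : R ^ (-2 * a) * R ^ (2 * γ) = R ^ (2 * (γ - a)) := by
      rw [← Real.rpow_add hR0]; ring_nf
    have hc : 1 / (2 * α) * (∫ x, w ‖x‖ * (‖x‖ ^ 2 * e x)) ≤ 1 / (2 * α) *
        (2 * a * (∫ x, η x * e x) + 4 * M * R ^ (-2 * a) * (C * R ^ (2 * γ))) := by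
      refine mul_le_mul_of_nonneg_left ?_ (by positivity)
      linarith
    have hd : 1 / (2 * α) * (2 * a * (∫ x, η x * e x) + 4 * M * R ^ (-2 * a) *
        (C * R ^ (2 * γ))) = a / α * (∫ x, η x * e x) + 2 * M / α * C * R ^ (2 * (γ - a)) := by
      rw [← hpow]
      field_simp
      ring
    have hm : ∫ x, η x * e x ≤ 1 / (2 * α) * (∫ x, w ‖x‖ * (‖x‖ ^ 2 * e x)) := hmain
    show (1 - a / α) * ∫ x, η x * e x ≤ _
    linarith
  have h1a : 0 < 1 - a / α := by
    rw [sub_pos, div_lt_one hα0]; exact haα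
  have hball : ∀ N : ℕ, ∀ᵐ x ∂volume.restrict
      (Metric.closedBall (0 : EuclideanSpace ℝ (Fin 2)) N), V x = 0 := by
    intro N
    set B := Metric.closedBall (0 : EuclideanSpace ℝ (Fin 2)) (N : ℝ) with hB
    have hBe : IntegrableOn e B volume := hel.integrableOn_isCompact (isCompact_closedBall _ _)
    set c : ℝ := (1 + (N : ℝ) ^ 2) ^ (-a) with hc
    have hc0 : 0 < c := by positivity
    -- On the fixed ball the weight is at least `c` once `R ≥ N`, so the bound persists as `R → ∞`
    -- and forces zero energy there.
    have hle : ∀ R : ℝ, max 1 (N : ℝ) ≤ R → (1 - a / α) * (c * ∫ x in B, e x) ≤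
        2 * M / α * C * R ^ (2 * (γ - a)) := by
      intro R hR
      have hR1 : 1 ≤ R := (le_max_left _ _).trans hR
      have hRN : (N : ℝ) ≤ R := (le_max_right _ _).trans hR
      have hR0 : 0 < R := by linarith
      refine le_trans (mul_le_mul_of_nonneg_left ?_ h1a.le) (hdecay R hR1)
      have hcut := isTestFunction_cutoff (n := 2) (show 0 < R ^ 2 by positivity)
      have hcont : Continuous fun x : EuclideanSpace ℝ (Fin 2) => (1 + ‖x‖ ^ 2) ^ (-a) :=
        Continuous.rpow_const (by fun_prop) fun r => Or.inl (by positivity)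
      have hI : Integrable (fun x => (1 + ‖x‖ ^ 2) ^ (-a) * cutoff (‖x‖ ^ 2 / R ^ 2) * e x)
          volume := integrable_continuous_mul (hcont.mul hcut.1.continuous) hcut.2.mul_left hel
      have hnn : ∀ x, 0 ≤ (1 + ‖x‖ ^ 2) ^ (-a) * cutoff (‖x‖ ^ 2 / R ^ 2) * e x := fun x =>
        mul_nonneg (mul_nonneg (by positivity) (cutoff_nonneg _)) (he0 x)
      rw [← integral_const_mul]
      refine le_trans (setIntegral_mono_on (hBe.const_mul c) hI.integrableOn
        measurableSet_closedBall fun x hx => ?_)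
        (setIntegral_le_integral hI (Eventually.of_forall hnn))
      have hxN : ‖x‖ ≤ N := mem_closedBall_zero_iff.1 hx
      refine mul_le_mul_of_nonneg_right ?_ (he0 x)
      have hx2 : ‖x‖ ^ 2 ≤ (N : ℝ) ^ 2 := pow_le_pow_left₀ (norm_nonneg _) hxN 2
      rw [cutoff_eq_one, mul_one]
      · exact Real.rpow_le_rpow_of_nonpos (by positivity) (by linarith) (by linarith)
      · rw [div_le_one (by positivity)]
        exact pow_le_pow_left₀ (norm_nonneg _) (hxN.trans hRN) 2
    have hlim : Tendsto (fun R : ℝ => 2 * M / α * C * R ^ (2 * (γ - a))) atTop (𝓝 0) := by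
      have := (tendsto_rpow_neg_atTop (show 0 < 2 * (a - γ) by linarith)).const_mul
        (2 * M / α * C)
      rw [mul_zero] at this
      refine this.congr fun R => ?_
      congr 2
      ring
    have hnp : (1 - a / α) * (c * ∫ x in B, e x) ≤ 0 :=
      ge_of_tendsto hlim ((eventually_ge_atTop _).mono hle)
    have hz : ∫ x in B, e x = 0 := by
      refine le_antisymm ?_ (integral_nonneg he0)
      by_contra hcon
      have := mul_pos h1a (mul_pos hc0 (not_le.1 hcon))
      linarith
    rw [setIntegral_eq_zero_iff_of_nonneg_ae (Eventually.of_forall he0) hBe] at hz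
    filter_upwards [hz] with x hx
    have hx' : e x = 0 := hx
    have := (hA.2.2 x (V x)).1
    rw [show (A x *ᵥ (V x).ofLp) ⬝ᵥ (V x).ofLp = 0 from hx'] at this
    have h0 : ‖V x‖ ^ 2 ≤ 0 := by
      by_contra hcon
      have := mul_pos hlam (not_le.1 hcon)
      linarith
    have : ‖V x‖ = 0 := by nlinarith [norm_nonneg (V x)]
    exact norm_eq_zero.1 this
  refine isAEConst_of_gradient_ae_zero h ?_
  have := (ae_restrict_iUnion_iff (fun N : ℕ =>
    Metric.closedBall (0 : EuclideanSpace ℝ (Fin 2)) N) fun x => V x = 0).2 hball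
  rw [Metric.iUnion_closedBall_nat, Measure.restrict_univ] at this
  exact this

end Growth

/-! ### The extremal matrix field and its solution. -/

section Extremal

open Filter Topology Set

/-- The function `(|x|² + ε) ^ ((a - 1) / 2) xᵢ`. For `ε = 0` it is homogeneous of degree `a`. -/
noncomputable def powCoord (a ε : ℝ) (i : Fin 2) (x : EuclideanSpace ℝ (Fin 2)) : ℝ :=
  (‖x‖ ^ 2 + ε) ^ ((a - 1) / 2) * x i

/-- The components of the gradient of `powCoord a ε i`. -/
noncomputable def powCoordDeriv (a ε : ℝ) (i j : Fin 2) (x : EuclideanSpace ℝ (Fin 2)) : ℝ :=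
  (‖x‖ ^ 2 + ε) ^ ((a - 1) / 2) * (if i = j then 1 else 0) +
    (a - 1) * (‖x‖ ^ 2 + ε) ^ ((a - 3) / 2) * x i * x j

theorem contDiff_powCoord (a : ℝ) {ε : ℝ} (hε : 0 < ε) (i : Fin 2) :
    ContDiff ℝ ∞ (powCoord a ε i) := by
  refine ContDiff.mul (ContDiff.rpow_const_of_ne ?_ fun x => by positivity) ?_
  · exact (contDiff_norm_sq ℝ).add contDiff_const
  · exact (EuclideanSpace.proj (𝕜 := ℝ) i).contDiff

theorem fderiv_powCoord (a : ℝ) {ε : ℝ} (hε : 0 < ε) (i j : Fin 2)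
    (x : EuclideanSpace ℝ (Fin 2)) :
    fderiv ℝ (powCoord a ε i) x (EuclideanSpace.single j 1) = powCoordDeriv a ε i j x := by
  have hs : ‖x‖ ^ 2 + ε ≠ 0 := by positivity
  have h1 := ((hasStrictFDerivAt_norm_sq x).hasFDerivAt.add_const ε).rpow_const
    (p := (a - 1) / 2) (Or.inl hs)
  have h2 := h1.mul (EuclideanSpace.proj (𝕜 := ℝ) i).hasFDerivAt
  rw [HasFDerivAt.fderiv (f := powCoord a ε i) h2, powCoordDeriv,
    show (a - 1) / 2 - 1 = (a - 3) / 2 by ring]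
  simp [EuclideanSpace.inner_single_right, PiLp.single_apply]
  ring

theorem abs_coord_mul_le (x : EuclideanSpace ℝ (Fin 2)) (i j : Fin 2) :
    |x i| * |x j| ≤ ‖x‖ ^ 2 := by
  have hi : |x i| ≤ ‖x‖ := PiLp.norm_apply_le x i
  have hj : |x j| ≤ ‖x‖ := PiLp.norm_apply_le x j
  nlinarith [abs_nonneg (x i), abs_nonneg (x j)]

theorem rpow_norm_sq_add_le {a ε : ℝ} (ha : a ≤ 1) (hε : 0 ≤ ε) {x : EuclideanSpace ℝ (Fin 2)}
    (hx : x ≠ 0) : (‖x‖ ^ 2 + ε) ^ ((a - 1) / 2) ≤ ‖x‖ ^ (a - 1) := by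
  have h0 : 0 < ‖x‖ := norm_pos_iff.2 hx
  calc _ ≤ (‖x‖ ^ 2) ^ ((a - 1) / 2) :=
        Real.rpow_le_rpow_of_nonpos (by positivity) (by linarith) (by linarith)
    _ = _ := by
        rw [← Real.rpow_two, ← Real.rpow_mul h0.le]
        ring_nf

theorem abs_powCoord_le {a ε : ℝ} (ha : a ≤ 1) (hε : 0 ≤ ε) (i : Fin 2)
    (x : EuclideanSpace ℝ (Fin 2)) : |powCoord a ε i x| ≤ ‖x‖ ^ a := by
  rcases eq_or_ne x 0 with rfl | hx
  · simp only [powCoord, PiLp.zero_apply, mul_zero, abs_zero]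
    positivity
  have h0 : 0 < ‖x‖ := norm_pos_iff.2 hx
  rw [powCoord, abs_mul, abs_of_nonneg (by positivity)]
  calc _ ≤ ‖x‖ ^ (a - 1) * ‖x‖ := mul_le_mul (rpow_norm_sq_add_le ha hε hx)
        (PiLp.norm_apply_le x i) (abs_nonneg _) (by positivity)
    _ = ‖x‖ ^ a := by
        rw [← Real.rpow_add_one h0.ne']
        ring_nf

/-- The bound is uniform in `ε`, which provides the dominating function for `ε → 0`. -/
theorem abs_powCoordDeriv_le {a ε : ℝ} (ha0 : 0 ≤ a) (ha : a ≤ 1) (hε : 0 ≤ ε) (i j : Fin 2)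
    {x : EuclideanSpace ℝ (Fin 2)} (hx : x ≠ 0) :
    |powCoordDeriv a ε i j x| ≤ 2 * ‖x‖ ^ (a - 1) := by
  have h0 : 0 < ‖x‖ := norm_pos_iff.2 hx
  have hs : 0 < ‖x‖ ^ 2 + ε := by positivity
  set s := ‖x‖ ^ 2 + ε with hsd
  have hp : s ^ ((a - 3) / 2) * s = s ^ ((a - 1) / 2) := by
    rw [← Real.rpow_add_one hs.ne']
    ring_nf
  have hp0 : 0 ≤ s ^ ((a - 3) / 2) := by positivity
  have h1 : |s ^ ((a - 1) / 2) * (if i = j then 1 else 0)| ≤ s ^ ((a - 1) / 2) := by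
    split_ifs
    · rw [mul_one, abs_of_nonneg (by positivity)]
    · rw [mul_zero, abs_zero]; positivity
  have h2 : |(a - 1) * s ^ ((a - 3) / 2) * x i * x j| ≤ s ^ ((a - 1) / 2) := by
    rw [abs_mul, abs_mul, abs_mul, abs_of_nonneg hp0, ← hp]
    have h3 : |a - 1| ≤ 1 := abs_le.2 ⟨by linarith, by linarith⟩
    have h4 : |x i| * |x j| ≤ s := (abs_coord_mul_le x i j).trans (by linarith)
    calc _ = |a - 1| * (s ^ ((a - 3) / 2) * (|x i| * |x j|)) := by ring
      _ ≤ 1 * (s ^ ((a - 3) / 2) * s) := by gcongr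
      _ = _ := one_mul _
  have h5 := rpow_norm_sq_add_le ha hε hx
  rw [powCoordDeriv]
  refine (abs_add_le _ _).trans ?_
  linarith

theorem measurable_powCoord (a ε : ℝ) (i : Fin 2) : Measurable (powCoord a ε i) := by
  unfold powCoord
  fun_prop

theorem measurable_powCoordDeriv (a ε : ℝ) (i j : Fin 2) : Measurable (powCoordDeriv a ε i j) := by
  unfold powCoordDeriv
  fun_prop

theorem ae_ne_zero : ∀ᵐ x : EuclideanSpace ℝ (Fin 2), x ≠ 0 := by
  simp [ae_iff]

/-- In the plane `‖x‖^(2b)` is locally integrable when `2b > -2`. -/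
theorem memL2loc_of_abs_le_rpow {f : EuclideanSpace ℝ (Fin 2) → ℝ} (hf : Measurable f)
    {C b : ℝ} (hb : -1 < b) (h : ∀ᵐ x, |f x| ≤ C * ‖x‖ ^ b) : MemL2loc f := by
  have hl : LocallyIntegrable (fun x => f x ^ 2) volume := by
    refine locallyIntegrable_of_norm_le_rpow (C := C ^ 2) (α := -(2 * b)) (by simp) ?_ ?_
      (hf.pow_const 2).aestronglyMeasurable
    · simp only [finrank_euclideanSpace, Fintype.card_fin, Nat.cast_ofNat]
      linarith
    · filter_upwards [h] with x hx
      have h1 := pow_le_pow_left₀ (abs_nonneg _) hx 2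
      rw [mul_pow, ← Real.rpow_mul_natCast (norm_nonneg x)] at h1
      rw [norm_pow, Real.norm_eq_abs, neg_neg, mul_comm 2 b]
      exact h1
  intro K hK
  exact (memLp_two_iff_integrable_sq hf.aestronglyMeasurable).2 (hl.integrableOn_isCompact hK)

theorem memL2loc_powCoord {a ε : ℝ} (ha0 : 0 < a) (ha : a ≤ 1) (hε : 0 ≤ ε) (i : Fin 2) :
    MemL2loc (powCoord a ε i) :=
  memL2loc_of_abs_le_rpow (C := 1) (b := a) (measurable_powCoord a ε i) (by linarith)
    (Eventually.of_forall fun x => by simpa using abs_powCoord_le ha hε i x)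

theorem memL2loc_powCoordDeriv {a ε : ℝ} (ha0 : 0 < a) (ha : a ≤ 1) (hε : 0 ≤ ε) (i j : Fin 2) :
    MemL2loc (powCoordDeriv a ε i j) := by
  refine memL2loc_of_abs_le_rpow (C := 2) (measurable_powCoordDeriv a ε i j)
    (show -1 < a - 1 by linarith) ?_
  filter_upwards [ae_ne_zero] with x hx using abs_powCoordDeriv_le ha0.le ha hε i j hx

theorem tendsto_powCoord (a : ℝ) (i : Fin 2) {x : EuclideanSpace ℝ (Fin 2)} (hx : x ≠ 0) :
    Tendsto (fun k : ℕ => powCoord a (1 / ((k : ℝ) + 1)) i x) atTop (𝓝 (powCoord a 0 i x)) := by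
  have h0 : 0 < ‖x‖ := norm_pos_iff.2 hx
  have hc : ContinuousAt (fun ε : ℝ => powCoord a ε i x) 0 := by
    refine ContinuousAt.mul (ContinuousAt.rpow_const (by fun_prop) (Or.inl ?_)) (by fun_prop)
    positivity
  exact hc.tendsto.comp tendsto_one_div_add_atTop_nhds_zero_nat

theorem tendsto_powCoordDeriv (a : ℝ) (i j : Fin 2) {x : EuclideanSpace ℝ (Fin 2)} (hx : x ≠ 0) :
    Tendsto (fun k : ℕ => powCoordDeriv a (1 / ((k : ℝ) + 1)) i j x) atTop
      (𝓝 (powCoordDeriv a 0 i j x)) := by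
  have h0 : 0 < ‖x‖ := norm_pos_iff.2 hx
  have hr : ∀ b : ℝ, ContinuousAt (fun ε : ℝ => (‖x‖ ^ 2 + ε) ^ b) 0 := fun b =>
    ContinuousAt.rpow_const (by fun_prop) (Or.inl (by positivity))
  have hc : ContinuousAt (fun ε : ℝ => powCoordDeriv a ε i j x) 0 :=
    ((hr _).mul continuousAt_const).add
      (((continuousAt_const.mul (hr _)).mul continuousAt_const).mul continuousAt_const)
  exact hc.tendsto.comp tendsto_one_div_add_atTop_nhds_zero_nat

/-- The weak gradient of `|x| ^ (a - 1) xᵢ`. -/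
theorem isH1locWithGradient_powCoord {a : ℝ} (ha0 : 0 < a) (ha : a ≤ 1) (i : Fin 2) :
    IsH1locWithGradient (powCoord a 0 i)
      (fun x => WithLp.toLp 2 fun j => powCoordDeriv a 0 i j x) := by
  refine ⟨memL2loc_powCoord ha0 ha le_rfl i, fun K hK => ?_, fun φ hφ j => ?_⟩
  · have hm : Measurable fun x => (WithLp.toLp 2 fun j => powCoordDeriv a 0 i j x :
        EuclideanSpace ℝ (Fin 2)) := (MeasurableEquiv.toLp 2 (Fin 2 → ℝ)).measurable.comp
      (measurable_pi_iff.2 fun j => measurable_powCoordDeriv a 0 i j)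
    rw [memLp_two_iff_integrable_sq_norm hm.aestronglyMeasurable]
    simp only [norm_sq_eq]
    exact (memL2loc_powCoordDeriv ha0 ha le_rfl i 0 K hK).integrable_sq.add
      (memL2loc_powCoordDeriv ha0 ha le_rfl i 1 K hK).integrable_sq
  have hk : ∀ k : ℕ, (0 : ℝ) < 1 / ((k : ℝ) + 1) := fun k => by positivity
  have hgc := continuous_gradient_apply hφ.1 j
  have hgs := hasCompactSupport_gradient_apply hφ.2 j
  have hl : LocallyIntegrable (fun x : EuclideanSpace ℝ (Fin 2) => ‖x‖ ^ (a - 1)) volume := by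
    refine (memL2loc_of_abs_le_rpow (C := 1) (b := a - 1) (by fun_prop) (by linarith)
      (Eventually.of_forall fun x => ?_)).locallyIntegrable
    rw [abs_of_nonneg (by positivity), one_mul]
  have hl' : LocallyIntegrable (fun x : EuclideanSpace ℝ (Fin 2) => ‖x‖ ^ a) volume := by
    refine (memL2loc_of_abs_le_rpow (C := 1) (b := a) (by fun_prop) (by linarith)
      (Eventually.of_forall fun x => ?_)).locallyIntegrable
    rw [abs_of_nonneg (by positivity), one_mul]
  have hlim1 : Tendsto (fun k : ℕ => ∫ x, powCoord a (1 / ((k : ℝ) + 1)) i x * gradient φ x j)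
      atTop (𝓝 (∫ x, powCoord a 0 i x * gradient φ x j)) := by
    refine tendsto_integral_of_dominated_convergence (fun x => |gradient φ x j| * ‖x‖ ^ a)
      (fun k => ((measurable_powCoord a _ i).mul hgc.measurable).aestronglyMeasurable)
      (integrable_continuous_mul hgc.abs hgs.abs hl')
      (fun k => Eventually.of_forall fun x => ?_) ?_
    · rw [norm_mul, mul_comm, Real.norm_eq_abs, Real.norm_eq_abs]
      exact mul_le_mul_of_nonneg_left (abs_powCoord_le ha (hk k).le i x) (abs_nonneg _)
    · filter_upwards [ae_ne_zero] with x hx using (tendsto_powCoord a i hx).mul_const _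
  have hlim2 : Tendsto (fun k : ℕ => -∫ x, powCoordDeriv a (1 / ((k : ℝ) + 1)) i j x * φ x)
      atTop (𝓝 (-∫ x, powCoordDeriv a 0 i j x * φ x)) := by
    refine (tendsto_integral_of_dominated_convergence (fun x => 2 * (|φ x| * ‖x‖ ^ (a - 1)))
      (fun k => ((measurable_powCoordDeriv a _ i j).mul
        hφ.1.continuous.measurable).aestronglyMeasurable)
      ((integrable_continuous_mul hφ.1.continuous.abs hφ.2.abs hl).const_mul 2)
      (fun k => ?_) ?_).neg
    · filter_upwards [ae_ne_zero] with x hx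
      rw [Pi.mul_apply, norm_mul, Real.norm_eq_abs, Real.norm_eq_abs]
      have := mul_le_mul_of_nonneg_right (abs_powCoordDeriv_le ha0.le ha (hk k).le i j hx)
        (abs_nonneg (φ x))
      linarith
    · filter_upwards [ae_ne_zero] with x hx using (tendsto_powCoordDeriv a i j hx).mul_const _
  -- For `ε > 0` the function is smooth and ordinary integration by parts applies. The limit `ε → 0`
  -- shows that the origin contributes no extra term.
  refine tendsto_nhds_unique hlim1 (hlim2.congr fun k => ?_)
  have hu := contDiff_powCoord a (hk k) i
  have hd := hu.continuous_fderiv (by simp)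
  simp only [gradient_apply, ← fderiv_powCoord a (hk k)]
  rw [integral_mul_fderiv_eq_neg_fderiv_mul_of_integrable]
  · exact ((hd.clm_apply continuous_const).mul hφ.1.continuous).integrable_of_hasCompactSupport
      hφ.2.mul_left
  · simp only [← gradient_apply]
    exact (hu.continuous.mul hgc).integrable_of_hasCompactSupport hgs.mul_left
  · exact (hu.continuous.mul hφ.1.continuous).integrable_of_hasCompactSupport hφ.2.mul_left
  · exact fun x _ => hu.differentiable (by simp) x
  · exact fun x _ => hφ.1.differentiable (by simp) x

/-- The matrix field with eigenvalue `L` in the radial and `lam` in the angular direction. -/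
noncomputable def radialMatrix (lam L : ℝ) (x : EuclideanSpace ℝ (Fin 2)) :
    Matrix (Fin 2) (Fin 2) ℝ :=
  Matrix.of fun i j => lam * (if i = j then 1 else 0) + (L - lam) * ((‖x‖ ^ 2)⁻¹ * (x i * x j))

theorem radialMatrix_mulVec_apply (lam L : ℝ) (x : EuclideanSpace ℝ (Fin 2)) (v : Fin 2 → ℝ)
    (i : Fin 2) : (radialMatrix lam L x *ᵥ v) i =
      lam * v i + (L - lam) * ((‖x‖ ^ 2)⁻¹ * x i * (x 0 * v 0 + x 1 * v 1)) := by
  simp only [radialMatrix, Matrix.mulVec, dotProduct, Fin.sum_univ_two, Matrix.of_apply]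
  fin_cases i <;> simp <;> ring

theorem radialMatrix_mem_ellipticClass {lam L : ℝ} (hL : lam ≤ L) :
    radialMatrix lam L ∈ EllipticClass 2 lam L := by
  refine ⟨fun i j => Measurable.aemeasurable ?_, fun x => ?_, fun x ξ => ?_⟩
  · simp only [radialMatrix, Matrix.of_apply]
    fun_prop
  · ext i j
    simp only [radialMatrix, Matrix.transpose_apply, Matrix.of_apply, eq_comm, mul_comm (x i)]
  · have hq : (radialMatrix lam L x *ᵥ ξ.ofLp) ⬝ᵥ ξ.ofLp =
        lam * ‖ξ‖ ^ 2 + (L - lam) * ((‖x‖ ^ 2)⁻¹ * (x 0 * ξ 0 + x 1 * ξ 1) ^ 2) := by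
      simp only [dotProduct, Fin.sum_univ_two, radialMatrix_mulVec_apply, norm_sq_eq ξ]
      ring
    have h0 : 0 ≤ (‖x‖ ^ 2)⁻¹ * (x 0 * ξ 0 + x 1 * ξ 1) ^ 2 := by positivity
    have h1 : (‖x‖ ^ 2)⁻¹ * (x 0 * ξ 0 + x 1 * ξ 1) ^ 2 ≤ ‖ξ‖ ^ 2 := by
      -- At the origin the inverse takes the value `0`, so the matrix is `lam` times the identity;
      -- elsewhere the bound is Cauchy–Schwarz.
      rcases eq_or_ne x 0 with rfl | hx
      · simp
      · have hx2 : 0 < ‖x‖ ^ 2 := by positivity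
        rw [inv_mul_le_iff₀ hx2, norm_sq_eq, norm_sq_eq]
        nlinarith [sq_nonneg (x 0 * ξ 1 - x 1 * ξ 0)]
    rw [hq]
    constructor <;> nlinarith

theorem isTestFunction_gradient_apply {φ : EuclideanSpace ℝ (Fin 2) → ℝ} (hφ : IsTestFunction φ)
    (i : Fin 2) : IsTestFunction (fun x => gradient φ x i) := by
  refine ⟨?_, hasCompactSupport_gradient_apply hφ.2 i⟩
  simp_rw [gradient_apply]
  exact (hφ.1.fderiv_right (m := ∞) (by simp)).clm_apply contDiff_const

theorem gradient_gradient_apply_comm {φ : EuclideanSpace ℝ (Fin 2) → ℝ} (hφ : ContDiff ℝ ∞ φ)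
    (i j : Fin 2) (x : EuclideanSpace ℝ (Fin 2)) :
    gradient (fun y => gradient φ y i) x j = gradient (fun y => gradient φ y j) x i := by
  have hd : DifferentiableAt ℝ (fderiv ℝ φ) x :=
    (hφ.fderiv_right (m := ∞) (by simp)).differentiable (by simp) x
  have key : ∀ i j : Fin 2, gradient (fun y => gradient φ y i) x j =
      fderiv ℝ (fderiv ℝ φ) x (EuclideanSpace.single j 1) (EuclideanSpace.single i 1) := by
    intro i j
    simp_rw [gradient_apply]
    rw [fderiv_clm_apply hd (differentiableAt_const _)]
    simp
  rw [key, key]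
  exact (hφ.contDiffAt.isSymmSndFDerivAt
    (by simp only [minSmoothness_of_isRCLikeNormedField]; exact ENat.LEInfty.out)).eq _ _

/-- In dimension two, the rotated gradient of `|x| ^ (a - 1) x₁` is the flux of
`|x| ^ (a - 1) x₀`. -/
theorem isWeakSolution_powCoord {lam L a : ℝ} (ha0 : 0 < a) (ha : a ≤ 1) (hlam : lam = L * a ^ 2) :
    IsWeakSolution (radialMatrix lam L) (powCoord a 0 0) := by
  refine ⟨_, isH1locWithGradient_powCoord ha0 ha 0, fun φ hφ => ?_⟩
  obtain ⟨-, -, hw⟩ := isH1locWithGradient_powCoord ha0 ha 1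
  -- In polar form, with `u = r^a cos θ` and `v = r^a sin θ`, this says `L ∂ᵣu = L a r⁻¹ ∂_θ v` and
  -- `lam r⁻¹ ∂_θ u = -L a ∂ᵣv`; the second relation is where `lam = L a²` is needed.
  have hflux : ∀ᵐ x : EuclideanSpace ℝ (Fin 2),
      (radialMatrix lam L x *ᵥ (WithLp.toLp 2 fun j => powCoordDeriv a 0 0 j x :
        EuclideanSpace ℝ (Fin 2)).ofLp) ⬝ᵥ (gradient φ x).ofLp =
      L * a * (powCoordDeriv a 0 1 1 x * gradient φ x 0 -
        powCoordDeriv a 0 1 0 x * gradient φ x 1) := by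
    filter_upwards [ae_ne_zero] with x hx
    have hs : 0 < ‖x‖ ^ 2 := by positivity
    have hp : (‖x‖ ^ 2) ^ ((a - 1) / 2) = (‖x‖ ^ 2) ^ ((a - 3) / 2) * ‖x‖ ^ 2 := by
      rw [← Real.rpow_add_one hs.ne']
      ring_nf
    simp only [dotProduct, Fin.sum_univ_two, radialMatrix_mulVec_apply]
    have hn := norm_sq_eq x
    have hdot : x 0 * powCoordDeriv a 0 0 0 x + x 1 * powCoordDeriv a 0 0 1 x =
        ‖x‖ ^ 2 * (a * (‖x‖ ^ 2) ^ ((a - 3) / 2) * x 0) := by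
      simp only [powCoordDeriv, add_zero, hp, if_true, zero_ne_one, if_false]
      generalize (‖x‖ ^ 2) ^ ((a - 3) / 2) = p
      rw [hn]
      ring
    have hcan : ∀ i, (‖x‖ ^ 2)⁻¹ * x i * (‖x‖ ^ 2 * (a * (‖x‖ ^ 2) ^ ((a - 3) / 2) * x 0)) =
        x i * (a * (‖x‖ ^ 2) ^ ((a - 3) / 2) * x 0) := fun i => by field_simp
    rw [hdot, hcan, hcan]
    simp only [powCoordDeriv, add_zero, hp, hlam, if_true, zero_ne_one, one_ne_zero, if_false]
    generalize (‖x‖ ^ 2) ^ ((a - 3) / 2) = p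
    rw [hn]
    ring
  rw [integral_congr_ae hflux, integral_const_mul, integral_sub]
  · have h1 := hw _ (isTestFunction_gradient_apply hφ 0) 1
    have h2 := hw _ (isTestFunction_gradient_apply hφ 1) 0
    simp_rw [gradient_gradient_apply_comm hφ.1 0 1] at h1
    have h3 : ∫ x, powCoordDeriv a 0 1 1 x * gradient φ x 0 =
      ∫ x, powCoordDeriv a 0 1 0 x * gradient φ x 1 := by
      simp only at h1 h2
      linarith
    rw [h3]
    simp
  all_goals
    simp_rw [mul_comm (powCoordDeriv _ _ _ _ _)]
    exact integrable_continuous_mul (continuous_gradient_apply hφ.1 _)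
      (hasCompactSupport_gradient_apply hφ.2 _)
      (memL2loc_powCoordDeriv ha0 ha le_rfl _ _).locallyIntegrable

theorem hasGrowth_powCoord {a γ : ℝ} (ha0 : 0 < a) (ha : a ≤ 1) (hγ : a ≤ γ) (i : Fin 2) :
    HasGrowth (powCoord a 0 i) γ := by
  refine ⟨1, one_pos, Eventually.of_forall fun x => (abs_powCoord_le ha le_rfl i x).trans ?_⟩
  rw [one_mul]
  rcases le_total ‖x‖ 1 with h | h
  · have h1 : ‖x‖ ^ a ≤ 1 := Real.rpow_le_one (norm_nonneg _) h ha0.le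
    have h2 : 0 ≤ ‖x‖ ^ γ := by positivity
    linarith
  · have h1 : ‖x‖ ^ a ≤ ‖x‖ ^ γ := Real.rpow_le_rpow_of_exponent_le h hγ
    linarith

/-- The function has the sign of `xᵢ`, and a set of full measure is dense, so it meets both open
half planes. -/
theorem not_isAEConst_powCoord (a : ℝ) (i : Fin 2) : ¬ IsAEConst (powCoord a 0 i) := by
  rintro ⟨c, hc⟩
  have hd := Measure.dense_of_ae hc
  have hx : Continuous fun x : EuclideanSpace ℝ (Fin 2) => x i :=
    (EuclideanSpace.proj (𝕜 := ℝ) i).continuous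
  have hpos : ∀ x : EuclideanSpace ℝ (Fin 2), x i ≠ 0 → 0 < (‖x‖ ^ 2 + 0) ^ ((a - 1) / 2) := by
    intro x hxi
    have : x ≠ 0 := fun h => hxi (by rw [h]; rfl)
    positivity
  obtain ⟨y, hy, hyc⟩ := hd.inter_open_nonempty {x | 0 < x i} (isOpen_lt continuous_const hx)
    ⟨EuclideanSpace.single i 1, by simp⟩
  obtain ⟨z, hz, hzc⟩ := hd.inter_open_nonempty {x | x i < 0} (isOpen_lt hx continuous_const)
    ⟨EuclideanSpace.single i (-1), by simp⟩
  simp only [mem_ofPred_eq] at hy hyc hz hzc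
  have h1 : 0 < powCoord a 0 i y := mul_pos (hpos y hy.ne') hy
  have h2 : powCoord a 0 i z < 0 := mul_neg_of_pos_of_neg (hpos z hz.ne) hz
  linarith

end Extremal
end Liouville

theorem corollary3p1 (lam L : ℝ) (hlam : 0 < lam) (hL : lam ≤ L) :
    (∀ A ∈ Liouville.EllipticClass 2 lam L,
      ∀ u : EuclideanSpace ℝ (Fin 2) → ℝ, Liouville.IsWeakSolution A u →
        ∀ γ : ℝ, 0 < γ → γ < Real.sqrt (lam / L) → Liouville.HasGrowth u γ →
          Liouville.IsAEConst u) ∧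
    Liouville.IsOptimalLiouvilleExponent (Liouville.EllipticClass 2 lam L)
      (Real.sqrt (lam / L)) := by
  have hL0 : 0 < L := hlam.trans_le hL
  have hα : 0 < Real.sqrt (lam / L) := Real.sqrt_pos.2 (by positivity)
  have hα1 : Real.sqrt (lam / L) ≤ 1 := by
    rw [Real.sqrt_le_one, div_le_one hL0]
    exact hL
  have hlamα : lam = L * Real.sqrt (lam / L) ^ 2 := by
    rw [Real.sq_sqrt (by positivity)]
    field_simp
  refine ⟨fun A hA u hu γ hγ hγα hg =>
    Liouville.isAEConst_of_hasGrowth hlam hL0 hA hu hγ hγα hg, ?_, ?_⟩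
  -- An exponent above `√(lam/L)` is excluded by the extremal solution, whose growth is exactly
  -- `√(lam/L)`.
  · rintro γ ⟨-, hγ⟩
    by_contra hlt
    exact Liouville.not_isAEConst_powCoord _ 0 (hγ _ (Liouville.radialMatrix_mem_ellipticClass hL) _
      (Liouville.isWeakSolution_powCoord hα hα1 hlamα)
      (Liouville.hasGrowth_powCoord hα hα1 (not_le.1 hlt).le 0))
  · intro b hb
    by_contra hlt
    -- The maximum with `0` ensures that the chosen exponent is positive even if the upper bound `b`
    -- is negative.
    obtain ⟨γ, hγ1, hγ2⟩ := exists_between (max_lt (not_le.1 hlt) hα)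
    have hγ0 : 0 < γ := (le_max_right _ _).trans_lt hγ1
    have := hb ⟨hγ0, fun A hA u hu hg =>
      Liouville.isAEConst_of_hasGrowth hlam hL0 hA hu hγ0 hγ2 hg⟩
    exact absurd ((le_max_left _ _).trans_lt hγ1) (not_lt.2 this)
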